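/- Let $\Bbbk$ be a field of characteristic $0$, $A$ an associative unital $\Bbbk$-algebra, and let $(U,A)$, $(V,A)$ be left Hopf algebroids over $A$, i.e. left bialgebroids with source $s$, target $t$, coproduct $\Delta(u)=u_{(1)}\otimes_A u_{(2)}\in U_\triangleleft\otimes_A{}_\triangleright U$ (relations $t(a)x\otimes y=x\otimes s(a)y$) and counit $\varepsilon$, such that the map $u\otimes v\mapsto u_{(1)}\otimes_A u_{(2)}v$ from $U\otimes_{A^{op}}U$ (relations $x\,t(a)\otimes y=x\otimes t(a)y$) to $U_\triangleleft\otimes_A{}_\triangleright U$ is bijective; write $u_+\otimes_{A^{op}}u_-$ for the preimage of $u\otimes_A 1$. Let $\pi\colon U\to V$ be a surjective morphism of left Hopf algebroids and let $\gamma\colon V\to U$ be a morphism of $A$-corings with $\pi\circ\gamma=\mathrm{id}_V$ such that, for all $v\in V$, $a\in A$, $$\gamma(1_V)=1_U,\qquad \gamma(v\,t_V(a))=\gamma(v)\,t_U(a),\qquad \gamma(v\,s_V(a))=\gamma(v)\,s_U(a).$$ Assume that $U_\triangleleft$, i.e. $U$ with the right $A$-action $u\triangleleft a=t_U(a)u$,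 is a projective right $A$-module. Let $$B=\{u\in U\mid u_{(1)}\otimes_A\pi(u_{(2)})=u\otimes_A 1_V\}$$ be the left Hopf kernel of $\pi$, an $A$-ring (a $\Bbbk$-subalgebra of $U$) with unit map $s_U\colon A\to B$. Then: (1) The formula $v\rightharpoonup b=\gamma(v)_+\,b\,\gamma(v)_-$ is a weak left $V$-action on $B$, that is, it is $\Bbbk$-bilinear with values in $B$ and satisfies $(s(a)t(a')v)\rightharpoonup b=s_U(a)(v\rightharpoonup b)s_U(a')$, $v\rightharpoonup 1=s_U(\varepsilon(v))$, $v\rightharpoonup(bb')=(v_{(1)}\rightharpoonup b)(v_{(2)}\rightharpoonup b')$ and $1\rightharpoonup b=b$. (2) The formula $$\sigma(v,w)=t_U\varepsilon_U\big(\gamma(v_{(2)}w_{(2)})_+\big)\,\gamma(v_{(1)})\gamma(w_{(1)})\,\gamma(v_{(2)}w_{(2)})_-$$ gives a well-defined $\Bbbk$-linear map $\sigma\colon V\otimes_{A^{op}}V\to B$. Here an expression $t_U\varepsilon_U(y)\,x\,z$ attached to an element of $U_\triangleleft\otimes_A({}_\triangleright U\otimes_{A^{op}}U)$ is evaluated on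 its (unique) preimage in $(U\times_AU)\otimes_{A^{op}}U$, where $U\times_AU=\{\sum x_i\otimes y_i\in U_\triangleleft\otimes_A{}_\triangleright U\mid \sum x_it(a)\otimes y_i=\sum x_i\otimes y_is(a)\ \forall a\in A\}$. The map $\sigma$ is a $B$-valued Hopf $2$-cocycle: $\sigma(s(a)t(a')v,w)=s_U(a)\sigma(v,w)s_U(a')$, $(u_{(1)}\rightharpoonup s_U(a))\,\sigma(u_{(2)},v)=\sigma(u,s(a)v)$, $\sigma(1,u)=s_U(\varepsilon(u))=\sigma(u,1)$, and $$\big(u_{(1)}\rightharpoonup\sigma(v_{(1)},w_{(1)})\big)\,\sigma(u_{(2)},v_{(2)}w_{(2)})=\sigma(u_{(1)},v_{(1)})\,\sigma(u_{(2)}v_{(2)},w).$$ Moreover $B$ is a $\sigma$-twisted left $V$-module: $\big(u_{(1)}\rightharpoonup(v_{(1)}\rightharpoonup b)\big)\sigma(u_{(2)},v_{(2)})=\sigma(u_{(1)},v_{(1)})\,(u_{(2)}v_{(2)}\rightharpoonup b)$. (3) Let $B\#_\sigma V$ be the crossed product, i.e. $B\otimes_AV$ (relations $b\,s_U(a)\otimes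 v=b\otimes s_V(a)v$, with $b\# v$ the class of $b\otimes v$) with unit $1\#1$ and the well-defined associative multiplication $(b\# v)(b'\# w)=b\,(v_{(1)}\rightharpoonup b')\,\sigma(v_{(2)},w_{(1)})\,\#\,v_{(3)}w_{(2)}$. It is an $A\otimes A^{op}$-ring via $a\otimes a'\mapsto s_U(a)\# t_V(a')$ and a right $V$-comodule algebra via $b\# v\mapsto(b\# v_{(1)})\otimes_Av_{(2)}$, and $$\Phi\colon B\#_\sigma V\to U,\qquad b\# v\mapsto b\,\gamma(v)$$ is an isomorphism of $A\otimes A^{op}$-rings (with $a\otimes a'\mapsto s_U(a)t_U(a')$ on $U$) and of right $V$-comodule algebras (with coaction $u\mapsto u_{(1)}\otimes_A\pi(u_{(2)})$ on $U$). Its inverse is $$\Psi(u)=t_U\varepsilon_U\big(\gamma(\pi(u_{(2)}))_+\big)\,u_{(1)}\,\gamma(\pi(u_{(2)}))_-\ \#\ \pi(u_{(3)}),$$ where the expression in front of $\#$ is evaluated in the sense of (2) and lies in $B$. -/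

import Mathlib

open scoped TensorProduct
open MulOpposite (op)

noncomputable section

namespace Bialgd

section Balanced

variable {k A : Type*} [CommRing k]
variable {M N M' N' : Type*} [AddCommGroup M] [Module k M] [AddCommGroup N] [Module k N]
  [AddCommGroup M'] [Module k M'] [AddCommGroup N'] [Module k N']

/-- The relations `r a m ⊗ n = m ⊗ l a n` in `M ⊗ N`. -/
def balRel (r : A → Module.End k M) (l : A → Module.End k N) : Submodule k (M ⊗[k] N) :=
  Submodule.span k {z | ∃ (a : A) (m : M) (n : N), z = r a m ⊗ₜ[k] n - m ⊗ₜ[k] l a n}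

/-- The tensor product over the (noncommutative) `k`-algebra `A` of a right `A`-module `M`, with
action `m ◁ a = r a m`, and a left `A`-module `N`, with action `a ▹ n = l a n`. -/
def BalTensor (r : A → Module.End k M) (l : A → Module.End k N) :=
  (M ⊗[k] N) ⧸ balRel r l

instance (r : A → Module.End k M) (l : A → Module.End k N) :
    AddCommGroup (BalTensor r l) :=
  inferInstanceAs (AddCommGroup ((M ⊗[k] N) ⧸ balRel r l))

instance (r : A → Module.End k M) (l : A → Module.End k N) :
    Module k (BalTensor r l) :=
  inferInstanceAs (Module k ((M ⊗[k] N) ⧸ balRel r l))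

/-- The quotient map `M ⊗ N → M ⊗_A N`. -/
def BalTensor.mkQ (r : A → Module.End k M) (l : A → Module.End k N) :
    M ⊗[k] N →ₗ[k] BalTensor r l :=
  (balRel r l).mkQ

/-- The class `m ⊗_A n` of a pure tensor. -/
def BalTensor.tmul {r : A → Module.End k M} {l : A → Module.End k N} (m : M) (n : N) :
    BalTensor r l :=
  BalTensor.mkQ r l (m ⊗ₜ[k] n)

infixl:70 " ⊗ᵇ " => BalTensor.tmul

/-- The map `f ⊗_A g` for maps compatible with the actions. -/
def BalTensor.map {r : A → Module.End k M} {l : A → Module.End k N}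
    {r' : A → Module.End k M'} {l' : A → Module.End k N'}
    (f : M →ₗ[k] M') (g : N →ₗ[k] N')
    (hf : ∀ a m, f (r a m) = r' a (f m)) (hg : ∀ a n, g (l a n) = l' a (g n)) :
    BalTensor r l →ₗ[k] BalTensor r' l' :=
  Submodule.mapQ _ _ (TensorProduct.map f g) (by
    refine Submodule.span_le.2 ?_
    rintro _ ⟨a, m, n, rfl⟩
    refine Submodule.subset_span ⟨a, f m, g n, ?_⟩
    simp [hf, hg])

theorem BalTensor.map_tmul {r : A → Module.End k M} {l : A → Module.End k N}
    {r' : A → Module.End k M'} {l' : A → Module.End k N'}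
    (f : M →ₗ[k] M') (g : N →ₗ[k] N')
    (hf : ∀ a m, f (r a m) = r' a (f m)) (hg : ∀ a n, g (l a n) = l' a (g n)) (m : M) (n : N) :
    BalTensor.map f g hf hg (m ⊗ᵇ n : BalTensor r l) = (f m ⊗ᵇ g n : BalTensor r' l') := rfl

/-- The map induced by a balanced bilinear map. -/
def BalTensor.lift {r : A → Module.End k M} {l : A → Module.End k N} (f : M →ₗ[k] N →ₗ[k] M')
    (hf : ∀ a m n, f (r a m) n = f m (l a n)) : BalTensor r l →ₗ[k] M' :=
  (balRel r l).liftQ (TensorProduct.lift f) (by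
    refine Submodule.span_le.2 ?_
    rintro _ ⟨a, m, n, rfl⟩
    simp [hf])

theorem BalTensor.lift_tmul {r : A → Module.End k M} {l : A → Module.End k N}
    (f : M →ₗ[k] N →ₗ[k] M') (hf : ∀ a m n, f (r a m) n = f m (l a n)) (m : M) (n : N) :
    BalTensor.lift f hf (m ⊗ᵇ n : BalTensor r l) = f m n := rfl

theorem BalTensor.exists_rep {r : A → Module.End k M} {l : A → Module.End k N}
    (X : BalTensor r l) :
    ∃ (n : ℕ) (x : Fin n → M) (y : Fin n → N), X = ∑ i, x i ⊗ᵇ y i := by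
  obtain ⟨X, rfl⟩ := (balRel r l).mkQ_surjective X
  change ∃ (n : ℕ) (x : Fin n → M) (y : Fin n → N), BalTensor.mkQ r l X = ∑ i, x i ⊗ᵇ y i
  obtain ⟨n, x, y, rfl⟩ := TensorProduct.exists_sum_tmul_eq X
  exact ⟨n, x, y, by simp [BalTensor.tmul]⟩

end Balanced

section EnvRing

variable {k A R U V : Type*} [CommRing k] [Ring A] [Algebra k A] [Ring R] [Algebra k R]
  [Ring U] [Algebra k U] [Ring V] [Algebra k V]

/-- The tensor product `R_◁ ⊗_A ▹V`, with relations `t(a) x ⊗ y = x ⊗ s(a) y`. -/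
abbrev WTensor (t : Aᵐᵒᵖ →ₐ[k] R) (s : A →ₐ[k] V) :=
  BalTensor (fun a : A => LinearMap.mulLeft k (t (op a))) (fun a : A => LinearMap.mulLeft k (s a))

/-- `x ⊗ y ↦ x t(a) ⊗ y` on `R_◁ ⊗_A ▹V`. -/
def blackLeft (t : Aᵐᵒᵖ →ₐ[k] R) (s : A →ₐ[k] V) (a : A) : Module.End k (WTensor t s) :=
  BalTensor.map (LinearMap.mulRight k (t (op a))) LinearMap.id
    (fun b m => by simp [mul_assoc]) (fun _ _ => rfl)

/-- `x ⊗ y ↦ x ⊗ y s(a)` on `R_◁ ⊗_A ▹V`. -/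
def blackRight (t : Aᵐᵒᵖ →ₐ[k] R) (s : A →ₐ[k] V) (a : A) : Module.End k (WTensor t s) :=
  BalTensor.map LinearMap.id (LinearMap.mulRight k (s a))
    (fun _ _ => rfl) (fun b m => by simp [mul_assoc])

/-- Membership in the Sweedler-Takeuchi product `R ×_A V ⊆ R_◁ ⊗_A ▹V`:
`∑ xᵢ t(a) ⊗ yᵢ = ∑ xᵢ ⊗ yᵢ s(a)` for all `a`. -/
def IsTakeuchi {t : Aᵐᵒᵖ →ₐ[k] R} {s : A →ₐ[k] V} (X : WTensor t s) : Prop :=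
  ∀ a : A, blackLeft t s a X = blackRight t s a X

variable (k A U) in
/-- An `A ⊗ Aᵒᵖ`-ring: source `s`, an algebra map, and target `t`, an algebra antihomomorphism,
with commuting images (equivalently, an algebra map `a ⊗ a' ↦ s(a) t(a')`). -/
structure EnvRing where
  s : A →ₐ[k] U
  t : Aᵐᵒᵖ →ₐ[k] U
  comm : ∀ a b : A, s a * t (op b) = t (op b) * s a

namespace EnvRing

variable (E : EnvRing k A U)

/-- `U_◁ ⊗_A ▹U`. -/
abbrev Tensor := WTensor E.t E.s

/-- The left action `a ▹ (x ⊗ y) = s(a) x ⊗ y` on `U_◁ ⊗_A ▹U`. -/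
def leftS (a : A) : Module.End k E.Tensor :=
  BalTensor.map (LinearMap.mulLeft k (E.s a)) LinearMap.id
    (fun b m => by simp [← mul_assoc, E.comm]) (fun _ _ => rfl)

/-- `R_◁ ⊗_A ▹U_◁ ⊗_A ▹U`, bracketed to the right. -/
abbrev Tensor3 (t : Aᵐᵒᵖ →ₐ[k] R) :=
  BalTensor (fun a : A => LinearMap.mulLeft k (t (op a))) E.leftS

/-- `▶U ⊗_{Aᵒᵖ} U_◁`, with relations `x t(a) ⊗ y = x ⊗ t(a) y`. -/
abbrev OpTensor :=
  BalTensor (fun a : A => LinearMap.mulRight k (E.t (op a)))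
    (fun a : A => LinearMap.mulLeft k (E.t (op a)))

/-- The left action `a ▹ (x ⊗ y) = s(a) x ⊗ y` on `▶U ⊗_{Aᵒᵖ} U_◁`. -/
def opLeftS (a : A) : Module.End k E.OpTensor :=
  BalTensor.map (LinearMap.mulLeft k (E.s a)) LinearMap.id
    (fun b m => by simp [mul_assoc]) (fun _ _ => rfl)

/-- `U_◁ ⊗_A (▹▶U ⊗_{Aᵒᵖ} U_◁)`. -/
abbrev MixedTensor :=
  BalTensor (fun a : A => LinearMap.mulLeft k (E.t (op a))) E.opLeftS

/-- `U_◁`, the right `A`-module `U` with `u ◁ a = t(a) u`, is projective. -/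
def WhiteRightProjective : Prop :=
  @Module.Projective Aᵐᵒᵖ _ U _ (Module.compHom U (E.t : Aᵐᵒᵖ →+* U))

end EnvRing

end EnvRing

section Bialgebroid

variable {k A R U V B : Type*} [CommRing k] [Ring A] [Algebra k A] [Ring R] [Algebra k R]
  [Ring U] [Algebra k U] [Ring V] [Algebra k V] [Ring B] [Algebra k B]

variable (k A U) in
/-- A left bialgebroid `(U, A, Δ, ε, s, t)`.

Here and below an equation in Sweedler notation is required for all finite families
representing the coproducts in it: `comul u = ∑ i, x i ⊗ᵇ y i` stands for `u₍₁₎ ⊗_A u₍₂₎`. -/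
structure LeftBialgebroid extends EnvRing k A U where
  counit : U →ₗ[k] A
  counit_white : ∀ (b c : A) (u : U), counit (s b * t (op c) * u) = b * counit u * c
  counit_black : ∀ (a : A) (u : U), counit (u * t (op a)) = counit (u * s a)
  counit_mul : ∀ u v : U, counit (u * v) = counit (u * s (counit v))
  counit_one : counit 1 = 1
  comul : U →ₗ[k] toEnvRing.Tensor
  comul_takeuchi : ∀ u, IsTakeuchi (comul u)
  comul_actions : ∀ (a b c d : A) (u : U) {n : ℕ} (x y : Fin n → U),
    comul u = ∑ i, x i ⊗ᵇ y i →
    comul (t (op c) * s b * u * s d * t (op a)) =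
      ∑ i, (s b * x i * s d) ⊗ᵇ (t (op c) * y i * t (op a))
  comul_mul : ∀ (u v : U) {n m : ℕ} (x y : Fin n → U) (x' y' : Fin m → U),
    comul u = ∑ i, x i ⊗ᵇ y i → comul v = ∑ j, x' j ⊗ᵇ y' j →
    comul (u * v) = ∑ i, ∑ j, (x i * x' j) ⊗ᵇ (y i * y' j)
  comul_one : comul 1 = 1 ⊗ᵇ 1
  counit_comul : ∀ (u : U) {n : ℕ} (x y : Fin n → U), comul u = ∑ i, x i ⊗ᵇ y i →
    ∑ i, s (counit (x i)) * y i = u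
  comul_counit : ∀ (u : U) {n : ℕ} (x y : Fin n → U), comul u = ∑ i, x i ⊗ᵇ y i →
    ∑ i, t (op (counit (y i))) * x i = u
  coassoc : ∀ (u : U) {n m : ℕ} (x y : Fin n → U) (x' x'' : Fin n → Fin m → U),
    comul u = ∑ i, x i ⊗ᵇ y i → (∀ i, comul (x i) = ∑ j, x' i j ⊗ᵇ x'' i j) →
    (∑ i, ∑ j, x' i j ⊗ᵇ (x'' i j ⊗ᵇ y i) : toEnvRing.Tensor3 t) = ∑ i, x i ⊗ᵇ comul (y i)

variable (k A U) in
/-- A left Hopf algebroid: a left bialgebroid whose Hopf-Galois map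
`▶U ⊗_{Aᵒᵖ} U_◁ → U_◁ ⊗_A ▹U`, `u ⊗ v ↦ u₍₁₎ ⊗ u₍₂₎ v`, is invertible. -/
structure LeftHopfAlgebroid extends LeftBialgebroid k A U where
  galois : toEnvRing.OpTensor ≃ₗ[k] toEnvRing.Tensor
  galois_tmul : ∀ (u v : U) {n : ℕ} (x y : Fin n → U), comul u = ∑ i, x i ⊗ᵇ y i →
    galois (u ⊗ᵇ v) = ∑ i, x i ⊗ᵇ (y i * v)

/-- The translation map `u ↦ u₊ ⊗_{Aᵒᵖ} u₋`, the preimage of `u ⊗_A 1` under the Hopf-Galois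
map. -/
def LeftHopfAlgebroid.translation (𝒰 : LeftHopfAlgebroid k A U) (u : U) : 𝒰.OpTensor :=
  𝒰.galois.symm (u ⊗ᵇ 1)

/-- A morphism of left Hopf algebroids over the same base. -/
structure LeftHopfAlgebroid.Hom (𝒰 : LeftHopfAlgebroid k A U) (𝒱 : LeftHopfAlgebroid k A V) where
  hom : U →ₐ[k] V
  hom_s : ∀ a, hom (𝒰.s a) = 𝒱.s a
  hom_t : ∀ a, hom (𝒰.t a) = 𝒱.t a
  counit_hom : ∀ u, 𝒱.counit (hom u) = 𝒰.counit u
  comul_hom : ∀ u, 𝒱.comul (hom u) =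
    BalTensor.map hom.toLinearMap hom.toLinearMap
      (fun a m => by simp [hom_t]) (fun a m => by simp [hom_s]) (𝒰.comul u)
  translation_hom : ∀ u, 𝒱.translation (hom u) =
    BalTensor.map hom.toLinearMap hom.toLinearMap
      (fun a m => by simp [hom_t]) (fun a m => by simp [hom_t]) (𝒰.translation u)

/-- A morphism of the `A`-corings underlying two left bialgebroids. -/
structure CoringHom (𝒱 : LeftBialgebroid k A V) (𝒰 : LeftBialgebroid k A U) where
  hom : V →ₗ[k] U
  hom_s : ∀ a v, hom (𝒱.s a * v) = 𝒰.s a * hom v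
  hom_t : ∀ a v, hom (𝒱.t a * v) = 𝒰.t a * hom v
  counit_hom : ∀ v, 𝒰.counit (hom v) = 𝒱.counit v
  comul_hom : ∀ v, 𝒰.comul (hom v) =
    BalTensor.map hom hom (fun a m => hom_t (op a) m) (fun a m => hom_s a m) (𝒱.comul v)

/-- A right comodule algebra over the left bialgebroid `𝒱`: an `Aᵒᵖ`-ring `t : Aᵒᵖ → R`, with
`r ◁ a = t(a) r` and `a ▶ r = r t(a)`, and a coaction `R → R ×_A V ⊆ R_◁ ⊗_A ▹V` that is right
`A`-linear, coassociative, counital, multiplicative and unital. -/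
structure IsRightComoduleAlgebra (𝒱 : LeftBialgebroid k A V) (t : Aᵐᵒᵖ →ₐ[k] R)
    (δ : R →ₗ[k] WTensor t 𝒱.s) : Prop where
  takeuchi : ∀ r, IsTakeuchi (δ r)
  right_linear : ∀ (a : A) (r : R) {n : ℕ} (x : Fin n → R) (y : Fin n → V),
    δ r = ∑ i, x i ⊗ᵇ y i → δ (t (op a) * r) = ∑ i, x i ⊗ᵇ (𝒱.t (op a) * y i)
  coassoc : ∀ (r : R) {n m : ℕ} (x : Fin n → R) (y : Fin n → V)
    (x' : Fin n → Fin m → R) (x'' : Fin n → Fin m → V),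
    δ r = ∑ i, x i ⊗ᵇ y i → (∀ i, δ (x i) = ∑ j, x' i j ⊗ᵇ x'' i j) →
    (∑ i, ∑ j, x' i j ⊗ᵇ (x'' i j ⊗ᵇ y i) : 𝒱.Tensor3 t) = ∑ i, x i ⊗ᵇ 𝒱.comul (y i)
  counital : ∀ (r : R) {n : ℕ} (x : Fin n → R) (y : Fin n → V),
    δ r = ∑ i, x i ⊗ᵇ y i → ∑ i, t (op (𝒱.counit (y i))) * x i = r
  mul : ∀ (r r' : R) {n m : ℕ} (x : Fin n → R) (y : Fin n → V) (x' : Fin m → R) (y' : Fin m → V),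
    δ r = ∑ i, x i ⊗ᵇ y i → δ r' = ∑ j, x' j ⊗ᵇ y' j →
    δ (r * r') = ∑ i, ∑ j, (x i * x' j) ⊗ᵇ (y i * y' j)
  one : δ 1 = 1 ⊗ᵇ 1

/-! ### Measurings, cocycles, twisted modules, crossed products -/

/-- A measuring of the `A`-ring `ι : A → B` by the left bialgebroid `𝒱`. -/
structure Measuring (𝒱 : LeftBialgebroid k A V) (ι : A →ₐ[k] B) where
  act : V →ₗ[k] B →ₗ[k] B
  act_white : ∀ (a a' : A) (v : V) (b : B),
    act (𝒱.s a * 𝒱.t (op a') * v) b = ι a * act v b * ι a'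
  act_one : ∀ v, act v 1 = ι (𝒱.counit v)
  act_mul : ∀ (v : V) (b b' : B) {n : ℕ} (x y : Fin n → V), 𝒱.comul v = ∑ i, x i ⊗ᵇ y i →
    act v (b * b') = ∑ i, act (x i) b * act (y i) b'

variable {𝒱 : LeftBialgebroid k A V} {ι : A →ₐ[k] B}

/-- A `B`-valued Hopf 2-cocycle `σ : ▶V ⊗_{Aᵒᵖ} V_◁ → B`; `σ(v, w)` is `σ (v ⊗ᵇ w)`. -/
structure IsCocycle (M : Measuring 𝒱 ι) (σ : 𝒱.OpTensor →ₗ[k] B) : Prop where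
  white : ∀ (a a' : A) (v w : V),
    σ ((𝒱.s a * 𝒱.t (op a') * v) ⊗ᵇ w) = ι a * σ (v ⊗ᵇ w) * ι a'
  act_unit : ∀ (a : A) (u v : V) {n : ℕ} (x y : Fin n → V), 𝒱.comul u = ∑ i, x i ⊗ᵇ y i →
    ∑ i, M.act (x i) (ι a) * σ (y i ⊗ᵇ v) = σ (u ⊗ᵇ (𝒱.s a * v))
  one_left : ∀ u, σ (1 ⊗ᵇ u) = ι (𝒱.counit u)
  one_right : ∀ u, σ (u ⊗ᵇ 1) = ι (𝒱.counit u)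
  cocycle : ∀ (u v w : V) {n m l : ℕ} (x y : Fin n → V) (x' y' : Fin m → V) (x'' y'' : Fin l → V),
    𝒱.comul u = ∑ i, x i ⊗ᵇ y i → 𝒱.comul v = ∑ j, x' j ⊗ᵇ y' j →
    𝒱.comul w = ∑ h, x'' h ⊗ᵇ y'' h →
    ∑ i, ∑ j, ∑ h, M.act (x i) (σ (x' j ⊗ᵇ x'' h)) * σ (y i ⊗ᵇ (y' j * y'' h)) =
      ∑ i, ∑ j, σ (x i ⊗ᵇ x' j) * σ ((y i * y' j) ⊗ᵇ w)

/-- `B` is a `σ`-twisted left `𝒱`-module: `σ` is a 2-cocycle, the measuring is a weak action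
(`1 ▷ b = b`), and the twisted associativity holds. -/
structure IsTwistedModule (M : Measuring 𝒱 ι) (σ : 𝒱.OpTensor →ₗ[k] B) : Prop
    extends IsCocycle M σ where
  one_act : ∀ b, M.act 1 b = b
  twisted : ∀ (u v : V) (b : B) {n m : ℕ} (x y : Fin n → V) (x' y' : Fin m → V),
    𝒱.comul u = ∑ i, x i ⊗ᵇ y i → 𝒱.comul v = ∑ j, x' j ⊗ᵇ y' j →
    ∑ i, ∑ j, M.act (x i) (M.act (x' j) b) * σ (y i ⊗ᵇ y' j) =
      ∑ i, ∑ j, σ (x i ⊗ᵇ x' j) * M.act (y i * y' j) b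

/-- `B_▸ ⊗_A ▹V`, with relations `b ι(a) ⊗ v = b ⊗ s(a) v`. -/
abbrev BTensor (𝒱 : LeftBialgebroid k A V) (ι : A →ₐ[k] B) :=
  BalTensor (fun a : A => LinearMap.mulRight k (ι a)) (fun a : A => LinearMap.mulLeft k (𝒱.s a))

/-- The crossed product structure on `B_▸ ⊗_A ▹V`: the associative bilinear multiplication with
unit `1 ⊗ 1` and `(b ⊗ v)(b' ⊗ w) = b (v₍₁₎ ▷ b') σ(v₍₂₎, w₍₁₎) ⊗ v₍₃₎ w₍₂₎`. The formula
determines `mul`, so there is at most one such structure. -/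
structure CrossedProduct (M : Measuring 𝒱 ι) (σ : 𝒱.OpTensor →ₗ[k] B) where
  mul : BTensor 𝒱 ι →ₗ[k] BTensor 𝒱 ι →ₗ[k] BTensor 𝒱 ι
  mul_tmul : ∀ (b b' : B) (v w : V) {n m l : ℕ} (v₁ v₂₃ : Fin n → V) (v₂ v₃ : Fin n → Fin m → V)
    (w₁ w₂ : Fin l → V),
    𝒱.comul v = ∑ i, v₁ i ⊗ᵇ v₂₃ i → (∀ i, 𝒱.comul (v₂₃ i) = ∑ j, v₂ i j ⊗ᵇ v₃ i j) →
    𝒱.comul w = ∑ h, w₁ h ⊗ᵇ w₂ h →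
    mul (b ⊗ᵇ v) (b' ⊗ᵇ w) =
      ∑ i, ∑ j, ∑ h, (b * M.act (v₁ i) b' * σ (v₂ i j ⊗ᵇ w₁ h)) ⊗ᵇ (v₃ i j * w₂ h)
  mul_assoc : ∀ x y z, mul (mul x y) z = mul x (mul y z)
  one_mul : ∀ x, mul (1 ⊗ᵇ 1) x = x
  mul_one : ∀ x, mul x (1 ⊗ᵇ 1) = x

namespace CrossedProduct

variable {M : Measuring 𝒱 ι} {σ : 𝒱.OpTensor →ₗ[k] B}

/-- The underlying set `B_▸ ⊗_A ▹V` of the algebra `B #_σ V`. -/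
def Carrier (_ : CrossedProduct M σ) := BTensor 𝒱 ι

variable (C : CrossedProduct M σ)

instance : AddCommGroup C.Carrier := inferInstanceAs (AddCommGroup (BTensor 𝒱 ι))

instance : Module k C.Carrier := inferInstanceAs (Module k (BTensor 𝒱 ι))

instance : Ring C.Carrier where
  __ := (inferInstance : AddCommGroup C.Carrier)
  mul x y := C.mul x y
  one := (1 ⊗ᵇ 1 : BTensor 𝒱 ι)
  mul_assoc := C.mul_assoc
  one_mul := C.one_mul
  mul_one := C.mul_one
  zero_mul x := LinearMap.map_zero₂ C.mul x
  mul_zero x := (C.mul x).map_zero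
  left_distrib x y z := (C.mul x).map_add y z
  right_distrib x y z := by
    change C.mul (x + y) z = C.mul x z + C.mul y z
    exact LinearMap.map_add₂ C.mul x y z

instance : Algebra k C.Carrier :=
  Algebra.ofModule (fun c x y => LinearMap.map_smul₂ C.mul c x y)
    (fun c x y => (C.mul x).map_smul c y)

/-- The element `b # v` of `B #_σ V`. -/
def tmul (b : B) (v : V) : C.Carrier := (b ⊗ᵇ v : BTensor 𝒱 ι)

end CrossedProduct

/-! ### The left Hopf kernel -/

namespace LeftHopfAlgebroid

variable {𝒰 : LeftHopfAlgebroid k A U} {𝒱 : LeftHopfAlgebroid k A V}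

/-- The map `U ⊗_A π : U_◁ ⊗_A ▹U → U_◁ ⊗_A ▹V`. -/
def Hom.idTensor (π : 𝒰.Hom 𝒱) : 𝒰.Tensor →ₗ[k] WTensor 𝒰.t 𝒱.s :=
  BalTensor.map LinearMap.id π.hom.toLinearMap (fun _ _ => rfl) (fun a m => by simp [π.hom_s])

theorem Hom.idTensor_tmul (π : 𝒰.Hom 𝒱) (x y : U) :
    π.idTensor (x ⊗ᵇ y) = x ⊗ᵇ π.hom y := rfl

/-- The coaction `(U ⊗_A π) Δ : U → U_◁ ⊗_A ▹V`. -/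
def Hom.coaction (π : 𝒰.Hom 𝒱) : U →ₗ[k] WTensor 𝒰.t 𝒱.s :=
  π.idTensor ∘ₗ 𝒰.comul

theorem Hom.coaction_eq (π : 𝒰.Hom 𝒱) {u : U} {n : ℕ} {x y : Fin n → U}
    (h : 𝒰.comul u = ∑ i, x i ⊗ᵇ y i) : π.coaction u = ∑ i, x i ⊗ᵇ π.hom (y i) := by
  simp only [Hom.coaction, LinearMap.comp_apply, h, map_sum, Hom.idTensor_tmul]

theorem Hom.mul_t_of_coaction (π : 𝒰.Hom 𝒱) {b : U} (hb : π.coaction b = b ⊗ᵇ 1) (a : A) :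
    b * 𝒰.t (op a) = 𝒰.t (op a) * b := by
  obtain ⟨n, x, y, h⟩ := BalTensor.exists_rep (𝒰.comul b)
  have h1 := 𝒰.comul_actions a 1 1 1 b x y h
  simp only [MulOpposite.op_one, map_one, one_mul, mul_one] at h1
  have h2 := 𝒰.comul_counit _ _ _ h1
  let f : U →ₗ[k] V →ₗ[k] U :=
    LinearMap.mk₂ k (fun x v => 𝒰.t (op (𝒱.counit (v * 𝒱.t (op a)))) * x)
      (fun _ _ _ => mul_add _ _ _) (fun _ _ _ => mul_smul_comm _ _ _)
      (fun _ _ _ => by simp [add_mul]) (fun _ _ _ => by simp)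
  have hf : ∀ (c : A) (x : U) (v : V),
      f (LinearMap.mulLeft k (𝒰.t (op c)) x) v = f x (LinearMap.mulLeft k (𝒱.s c) v) := by
    intro c x v
    have := 𝒱.counit_white c 1 (v * 𝒱.t (op a))
    simp only [MulOpposite.op_one, map_one, mul_one] at this
    simp [f, mul_assoc, this]
  have h3 := congrArg (BalTensor.lift f hf) hb
  rw [π.coaction_eq h, map_sum] at h3
  simp only [BalTensor.lift_tmul] at h3
  have h4 := 𝒱.counit_white 1 a 1
  simp only [map_one, one_mul, mul_one, 𝒱.counit_one] at h4
  have h5 : ∀ v : U, 𝒱.counit (π.hom v * 𝒱.t (op a)) = 𝒰.counit (v * 𝒰.t (op a)) := by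
    intro v
    rw [← π.hom_t, ← map_mul, π.counit_hom]
  simp only [f, LinearMap.mk₂_apply, h5, one_mul, h4] at h3
  rw [← h2, h3]

/-- The left Hopf kernel `B = {u | (U ⊗_A π) Δ u = u ⊗_A 1}`, a subalgebra of `U`. -/
def Hom.kernel (π : 𝒰.Hom 𝒱) : Subalgebra k U where
  carrier := {u | π.coaction u = u ⊗ᵇ 1}
  mul_mem' := by
    intro b b' hb hb'
    obtain ⟨n, x, y, h⟩ := BalTensor.exists_rep (𝒰.comul b)
    obtain ⟨m, x', y', h'⟩ := BalTensor.exists_rep (𝒰.comul b')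
    have ht := π.mul_t_of_coaction hb
    have key : ∀ j, (∑ i, (x i * x' j) ⊗ᵇ (π.hom (y i) * π.hom (y' j)) : WTensor 𝒰.t 𝒱.s) =
        (b * x' j) ⊗ᵇ π.hom (y' j) := by
      intro j
      let F : Module.End k (WTensor 𝒰.t 𝒱.s) := BalTensor.map (LinearMap.mulRight k (x' j))
        (LinearMap.mulRight k (π.hom (y' j)))
        (fun a m => by simp [mul_assoc]) (fun a m => by simp [mul_assoc])
      have hF : ∀ x v, F (x ⊗ᵇ v) = (x * x' j) ⊗ᵇ (v * π.hom (y' j)) := fun _ _ => rfl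
      have := congrArg F ((π.coaction_eq h).symm.trans hb)
      simpa only [map_sum, hF, one_mul] using this
    let G : Module.End k (WTensor 𝒰.t 𝒱.s) := BalTensor.map (LinearMap.mulLeft k b) LinearMap.id
      (fun a m => by simp [← mul_assoc, ht]) (fun a m => rfl)
    have hG : ∀ x v, G (x ⊗ᵇ v) = (b * x) ⊗ᵇ v := fun _ _ => rfl
    have key2 := congrArg G ((π.coaction_eq h').symm.trans hb')
    simp only [map_sum, hG] at key2
    change π.coaction (b * b') = (b * b') ⊗ᵇ 1
    rw [← key2, Hom.coaction, LinearMap.comp_apply, 𝒰.comul_mul b b' x y x' y' h h',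
      Finset.sum_comm]
    simp only [map_sum, Hom.idTensor_tmul, ← key, map_mul]
  add_mem' := by
    intro b b' hb hb'
    change π.coaction (b + b') = (b + b') ⊗ᵇ 1
    rw [map_add, hb, hb']
    simp [BalTensor.tmul, TensorProduct.add_tmul]
  algebraMap_mem' := by
    intro c
    change π.coaction _ = _ ⊗ᵇ 1
    rw [Algebra.algebraMap_eq_smul_one, map_smul, Hom.coaction, LinearMap.comp_apply, 𝒰.comul_one,
      Hom.idTensor_tmul]
    simp [BalTensor.tmul, ← TensorProduct.smul_tmul']

/-- The `A`-ring structure `s : A → B` of the left Hopf kernel. -/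
def Hom.kernelUnit (π : 𝒰.Hom 𝒱) : A →ₐ[k] π.kernel :=
  𝒰.s.codRestrict π.kernel (by
    intro a
    change π.coaction (𝒰.s a) = 𝒰.s a ⊗ᵇ 1
    have h := 𝒰.comul_actions 1 a 1 1 1 (fun _ : Fin 1 => 1) (fun _ => 1) (by simp [𝒰.comul_one])
    simp only [MulOpposite.op_one, map_one, one_mul, mul_one] at h
    rw [π.coaction_eq h]
    simp)

/-- `𝒰.Contracts X c`: the element `X` of `U_◁ ⊗_A (▹▶U ⊗_{Aᵒᵖ} U_◁)` comes from an element
`∑ⱼ (∑ᵢ xᵢⱼ ⊗ yᵢⱼ) ⊗ zⱼ` of `(U ×_A U) ⊗_{Aᵒᵖ} U_◁`, and `c = ∑ t(ε(yᵢⱼ)) xᵢⱼ zⱼ`. The expression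
`t(ε(y)) x z` is balanced only on `(U ×_A U) ⊗_{Aᵒᵖ} U_◁`; this is the meaning of formulas such as
`t(ε(u₍₂₎₊)) u₍₁₎ u₍₂₎₋`. -/
def Contracts (𝒰 : LeftHopfAlgebroid k A U) (X : 𝒰.MixedTensor) (c : U) : Prop :=
  ∃ (m n : ℕ) (x y : Fin m → Fin n → U) (z : Fin n → U),
    (∀ j, IsTakeuchi (∑ i, x i j ⊗ᵇ y i j : 𝒰.Tensor)) ∧
    X = ∑ j, ∑ i, x i j ⊗ᵇ (y i j ⊗ᵇ z j) ∧
    c = ∑ j, ∑ i, 𝒰.t (op (𝒰.counit (y i j))) * x i j * z j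

end LeftHopfAlgebroid

end Bialgebroid

end Bialgd

end

open Bialgd

/-!
The data of a crossed product are carried by the single map `φ : U → B`,
`φ(u) = t(ε(γ(π(u₍₂₎))₊)) u₍₁₎ γ(π(u₍₂₎))₋`. It is left `B`-linear, restricts to the identity on
`B`, satisfies `φ(γ(v)) = s(ε(v))`, and every `u` is recovered as `u = φ(u₍₁₎) γ(π(u₍₂₎))`; hence
`b ⊗ v ↦ b γ(v)` and `u ↦ φ(u₍₁₎) ⊗ π(u₍₂₎)` are mutually inverse, and all the structure is
transported from `U`. The weak action is `v ⇀ b = φ(γ(v) b)` and the cocycle is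
`σ(v, w) = φ(γ(v) γ(w))`, so the axioms of a twisted module are instances of associativity in `U`,
read through `φ` after expanding `γ(v) b` and `γ(v) γ(w)` by the recovery formula.

That `φ` takes its values in `B` is proved by cancelling `γ` under convolution: the two maps
`u ↦ φ(u)₍₁₎ ⊗ π(φ(u)₍₂₎)` and `u ↦ φ(u) ⊗ 1` have the same convolution with `γ`. The formula for
`φ` makes sense because `U_◁` is projective: a dual basis extends `x ⊗ y ⊗ z ↦ t(ε(y)) x z`,
which is balanced only over the Takeuchi product, to a map defined on the whole tensor product.
-/

noncomputable section

namespace Bialgd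

/-! ### Balanced tensor products -/

attribute [simp] BalTensor.map_tmul BalTensor.lift_tmul LeftHopfAlgebroid.Hom.idTensor_tmul

namespace BalTensor

variable {k A : Type*} [CommRing k]
variable {M N P M' N' : Type*} [AddCommGroup M] [Module k M] [AddCommGroup N] [Module k N]
  [AddCommGroup P] [Module k P] [AddCommGroup M'] [Module k M'] [AddCommGroup N'] [Module k N']
variable {r : A → Module.End k M} {l : A → Module.End k N}

/-- The bilinear map `(m, n) ↦ m ⊗_A n`. -/
def mk (r : A → Module.End k M) (l : A → Module.End k N) : M →ₗ[k] N →ₗ[k] BalTensor r l :=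
  (TensorProduct.mk k M N).compr₂ (mkQ r l)

@[simp]
theorem mk_apply (m : M) (n : N) : mk r l m n = m ⊗ᵇ n := rfl

theorem add_tmul (m m' : M) (n : N) :
    ((m + m') ⊗ᵇ n : BalTensor r l) = m ⊗ᵇ n + m' ⊗ᵇ n := LinearMap.map_add₂ (mk r l) m m' n

theorem tmul_add (m : M) (n n' : N) :
    (m ⊗ᵇ (n + n') : BalTensor r l) = m ⊗ᵇ n + m ⊗ᵇ n' := map_add (mk r l m) n n'

@[simp]
theorem zero_tmul (n : N) : (0 ⊗ᵇ n : BalTensor r l) = 0 := LinearMap.map_zero₂ (mk r l) n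

theorem smul_tmul (c : k) (m : M) (n : N) :
    ((c • m) ⊗ᵇ n : BalTensor r l) = c • (m ⊗ᵇ n) := LinearMap.map_smul₂ (mk r l) c m n

theorem tmul_smul (c : k) (m : M) (n : N) :
    (m ⊗ᵇ (c • n) : BalTensor r l) = c • (m ⊗ᵇ n) := map_smul (mk r l m) c n

theorem sum_tmul {ι : Type*} (S : Finset ι) (m : ι → M) (n : N) :
    ((∑ i ∈ S, m i) ⊗ᵇ n : BalTensor r l) = ∑ i ∈ S, m i ⊗ᵇ n :=
  LinearMap.map_sum₂ (mk r l) S m n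

theorem tmul_sum {ι : Type*} (S : Finset ι) (m : M) (n : ι → N) :
    (m ⊗ᵇ (∑ i ∈ S, n i) : BalTensor r l) = ∑ i ∈ S, m ⊗ᵇ n i :=
  map_sum (mk r l m) n S

theorem act_tmul (a : A) (m : M) (n : N) :
    (r a m ⊗ᵇ n : BalTensor r l) = m ⊗ᵇ l a n :=
  (Submodule.Quotient.eq _).2 (Submodule.subset_span ⟨a, m, n, rfl⟩)

theorem ext {f g : BalTensor r l →ₗ[k] P} (h : ∀ m n, f (m ⊗ᵇ n) = g (m ⊗ᵇ n)) : f = g := by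
  ext X
  obtain ⟨n, x, y, rfl⟩ := exists_rep X
  simp only [map_sum, h]

@[elab_as_elim]
theorem induction_on {p : BalTensor r l → Prop} (X : BalTensor r l) (zero : p 0)
    (tmul : ∀ m n, p (m ⊗ᵇ n)) (add : ∀ X Y, p X → p Y → p (X + Y)) : p X := by
  obtain ⟨n, x, y, rfl⟩ := exists_rep X
  exact Finset.sum_induction _ p add zero fun i _ => tmul _ _

theorem exists_rep_family {n : ℕ} (X : Fin n → BalTensor r l) :
    ∃ (m : ℕ) (x : Fin n → Fin m → M) (y : Fin n → Fin m → N),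
      ∀ i, X i = ∑ j, x i j ⊗ᵇ y i j := by
  choose m x y h using fun i => exists_rep (X i)
  let e := Fintype.equivFin (Σ i, Fin (m i))
  refine ⟨_, fun i j => if (e.symm j).1 = i then x _ (e.symm j).2 else 0,
    fun _ j => y _ (e.symm j).2, fun i => ?_⟩
  rw [e.symm.sum_comp (fun p : Σ i, Fin (m i) =>
    ((if p.1 = i then x _ p.2 else 0) ⊗ᵇ y _ p.2 : BalTensor r l)), Fintype.sum_sigma,
    Finset.sum_eq_single i]
  · simp [h i]
  · intro i' _ hi
    simp [hi]
  · simp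

theorem map_injective {r' : A → Module.End k M'} {l' : A → Module.End k N'}
    (f : M ≃ₗ[k] M') (g : N ≃ₗ[k] N') (hf : ∀ a m, f (r a m) = r' a (f m))
    (hg : ∀ a n, g (l a n) = l' a (g n)) :
    Function.Injective (map (f : M →ₗ[k] M') (g : N →ₗ[k] N') hf hg) := by
  refine Function.LeftInverse.injective (g := map (f.symm : M' →ₗ[k] M) (g.symm : N' →ₗ[k] N)
    (fun a m => f.injective (by simp [hf])) (fun a m => g.injective (by simp [hg]))) fun X => ?_
  obtain ⟨n, x, y, rfl⟩ := exists_rep X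
  simp

section Assoc

variable {C : Type*} {r₂ : C → Module.End k N} {l₂ : C → Module.End k P}
  {L : A → Module.End k (BalTensor r₂ l₂)}

theorem exists_rep_nested (X : BalTensor r L) :
    ∃ (n : ℕ) (x : Fin n → M) (y : Fin n → N) (z : Fin n → P),
      X = ∑ i, x i ⊗ᵇ (y i ⊗ᵇ z i) := by
  obtain ⟨n, x, Y, rfl⟩ := exists_rep X
  obtain ⟨m, y, z, h⟩ := exists_rep_family Y
  let e := finProdFinEquiv (m := n) (n := m)
  refine ⟨n * m, fun i => x (e.symm i).1, fun i => y (e.symm i).1 (e.symm i).2,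
    fun i => z (e.symm i).1 (e.symm i).2, ?_⟩
  rw [e.symm.sum_comp (fun p : Fin n × Fin m =>
    (x p.1 ⊗ᵇ (y p.1 p.2 ⊗ᵇ z p.1 p.2) : BalTensor r L)), Fintype.sum_prod_type]
  simp only [h, tmul_sum]

theorem ext_nested {f g : BalTensor r L →ₗ[k] M'}
    (h : ∀ m n p, f (m ⊗ᵇ (n ⊗ᵇ p)) = g (m ⊗ᵇ (n ⊗ᵇ p))) : f = g := by
  ext X
  obtain ⟨n, x, y, z, rfl⟩ := exists_rep_nested X
  simp only [map_sum, h]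

variable (hL : ∀ a n p, L a (n ⊗ᵇ p) = l a n ⊗ᵇ p)

/-- The associativity constraint `(m ⊗ n, p) ↦ m ⊗ (n ⊗ p)`, for a left action `L` on the
right-hand factor that comes from the action `l` on `N`. -/
def insertRight : BalTensor r l →ₗ[k] P →ₗ[k] BalTensor r L :=
  lift ((LinearMap.llcomp k P _ _ ∘ₗ mk r L).compl₂ (mk r₂ l₂)) fun a m n => by
    ext p
    simpa [hL] using act_tmul (r := r) (l := L) a m (n ⊗ᵇ p)

@[simp]
theorem insertRight_tmul (m : M) (n : N) (p : P) :
    insertRight hL (m ⊗ᵇ n : BalTensor r l) p = (m ⊗ᵇ (n ⊗ᵇ p) : BalTensor r L) := rfl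

variable {Q : Type*} [AddCommGroup Q] [Module k Q]
  {r' : C → Module.End k M'} {l' : C → Module.End k Q}

/-- The map `m ⊗ (n ⊗ p) ↦ f(m ⊗ n) ⊗ g(p)`. -/
def mapAssoc (f : BalTensor r l →ₗ[k] M') (g : P →ₗ[k] Q)
    (hf : ∀ c m n, f (m ⊗ᵇ r₂ c n) = r' c (f (m ⊗ᵇ n))) (hg : ∀ c p, g (l₂ c p) = l' c (g p)) :
    BalTensor r L →ₗ[k] BalTensor r' l' :=
  lift
    (LinearMap.mk₂ k (fun m => map (f ∘ₗ mk r l m) g (by simpa using (hf · m)) hg)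
      (fun m m' Y => by
        obtain ⟨n, y, z, rfl⟩ := exists_rep Y
        simp [add_tmul, Finset.sum_add_distrib])
      (fun c m Y => by
        obtain ⟨n, y, z, rfl⟩ := exists_rep Y
        simp [smul_tmul, Finset.smul_sum])
      (fun _ => map_add _) (fun _ _ => map_smul _ _))
    (fun a m Y => by
      obtain ⟨n, y, z, rfl⟩ := exists_rep Y
      simp [hL, act_tmul])

@[simp]
theorem mapAssoc_tmul (f : BalTensor r l →ₗ[k] M') (g : P →ₗ[k] Q)
    (hf : ∀ c m n, f (m ⊗ᵇ r₂ c n) = r' c (f (m ⊗ᵇ n))) (hg : ∀ c p, g (l₂ c p) = l' c (g p))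
    (m : M) (n : N) (p : P) :
    mapAssoc hL f g hf hg (m ⊗ᵇ (n ⊗ᵇ p)) = (f (m ⊗ᵇ n) ⊗ᵇ g p : BalTensor r' l') := by
  simp [mapAssoc]

theorem mapAssoc_insertRight (f : BalTensor r l →ₗ[k] M') (g : P →ₗ[k] Q)
    (hf : ∀ c m n, f (m ⊗ᵇ r₂ c n) = r' c (f (m ⊗ᵇ n))) (hg : ∀ c p, g (l₂ c p) = l' c (g p))
    (X : BalTensor r l) (p : P) :
    mapAssoc hL f g hf hg (insertRight hL X p) = (f X ⊗ᵇ g p : BalTensor r' l') := by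
  obtain ⟨n, x, y, rfl⟩ := exists_rep X
  simp [sum_tmul]

end Assoc

end BalTensor

/-! ### Tensor products over the base of a bialgebroid -/

section EnvRing

variable {k A R U V : Type*} [CommRing k] [Ring A] [Algebra k A] [Ring R] [Algebra k R]
  [Ring U] [Algebra k U] [Ring V] [Algebra k V]

section WTensor

variable {t : Aᵐᵒᵖ →ₐ[k] R} {s : A →ₐ[k] V}

theorem WTensor.t_mul_tmul (a : A) (x : R) (y : V) :
    ((t (op a) * x) ⊗ᵇ y : WTensor t s) = x ⊗ᵇ (s a * y) :=
  BalTensor.act_tmul (r := fun a : A => LinearMap.mulLeft k (t (op a)))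
    (l := fun a : A => LinearMap.mulLeft k (s a)) a x y

@[simp]
theorem blackLeft_tmul (a : A) (x : R) (y : V) :
    blackLeft t s a (x ⊗ᵇ y) = (x * t (op a)) ⊗ᵇ y := rfl

@[simp]
theorem blackRight_tmul (a : A) (x : R) (y : V) :
    blackRight t s a (x ⊗ᵇ y) = x ⊗ᵇ (y * s a) := rfl

variable {R' N : Type*} [Ring R'] [Algebra k R'] [AddCommGroup N] [Module k N]
  {t' : Aᵐᵒᵖ →ₐ[k] R'} {l : A → Module.End k N}

/-- `f ⊗_A N : R_◁ ⊗_A N → R'_◁ ⊗_A N` for a right `A`-linear map `f`. -/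
def mapFst (f : R →ₗ[k] R') (hf : ∀ a x, f (t (op a) * x) = t' (op a) * f x) :
    BalTensor (fun a : A => LinearMap.mulLeft k (t (op a))) l →ₗ[k]
      BalTensor (fun a : A => LinearMap.mulLeft k (t' (op a))) l :=
  BalTensor.map f LinearMap.id hf (fun _ _ => rfl)

@[simp]
theorem mapFst_tmul (f : R →ₗ[k] R') (hf : ∀ a x, f (t (op a) * x) = t' (op a) * f x) (x : R)
    (y : N) : mapFst (l := l) f hf (x ⊗ᵇ y) = f x ⊗ᵇ y := rfl

theorem IsTakeuchi.mapFst {X : WTensor t s} (hX : IsTakeuchi X) (f : R →ₗ[k] R')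
    (hf : ∀ a x, f (t (op a) * x) = t' (op a) * f x)
    (hf' : ∀ a x, f (x * t (op a)) = f x * t' (op a)) : IsTakeuchi (mapFst f hf X) := by
  intro a
  have h := congrArg (Bialgd.mapFst f hf) (hX a)
  obtain ⟨n, x, v, rfl⟩ := BalTensor.exists_rep X
  simpa [hf'] using h

end WTensor

namespace EnvRing

variable (E : EnvRing k A U) (t : Aᵐᵒᵖ →ₐ[k] R)

/-- `R_◁ ⊗_A (▹▶U ⊗_{Aᵒᵖ} U_◁)`. -/
abbrev MixedOver :=
  BalTensor (fun a : A => LinearMap.mulLeft k (t (op a))) E.opLeftS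

/-- The rebracketing `(x ⊗ y, z) ↦ x ⊗ (y ⊗ z)` into `R_◁ ⊗_A (▹▶U ⊗_{Aᵒᵖ} U_◁)`. -/
def mkMixed : WTensor t E.s →ₗ[k] U →ₗ[k] E.MixedOver t :=
  BalTensor.insertRight fun _ _ _ => rfl

@[simp]
theorem mkMixed_tmul (x : R) (y z : U) : E.mkMixed t (x ⊗ᵇ y) z = x ⊗ᵇ (y ⊗ᵇ z) := rfl

/-- The rebracketing `(x ⊗ y, z) ↦ x ⊗ (y ⊗ z)` into `R_◁ ⊗_A ▹U_◁ ⊗_A ▹U`. -/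
def mkTensor3 : WTensor t E.s →ₗ[k] U →ₗ[k] E.Tensor3 t :=
  BalTensor.insertRight fun _ _ _ => rfl

@[simp]
theorem mkTensor3_tmul (x : R) (y z : U) : E.mkTensor3 t (x ⊗ᵇ y) z = x ⊗ᵇ (y ⊗ᵇ z) := rfl

theorem mapFst_mkMixed {R' : Type*} [Ring R'] [Algebra k R'] {t' : Aᵐᵒᵖ →ₐ[k] R'}
    (f : R →ₗ[k] R') (hf : ∀ a x, f (t (op a) * x) = t' (op a) * f x) (X : WTensor t E.s)
    (z : U) : mapFst f hf (E.mkMixed t X z) = E.mkMixed t' (mapFst f hf X) z := by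
  obtain ⟨n, x, y, rfl⟩ := BalTensor.exists_rep X
  simp

theorem OpTensor.mul_t_tmul (a : A) (x y : U) :
    ((x * E.t (op a)) ⊗ᵇ y : E.OpTensor) = x ⊗ᵇ (E.t (op a) * y) :=
  BalTensor.act_tmul (r := fun a : A => LinearMap.mulRight k (E.t (op a)))
    (l := fun a : A => LinearMap.mulLeft k (E.t (op a))) a x y

@[simp]
theorem opLeftS_tmul (a : A) (x y : U) : E.opLeftS a (x ⊗ᵇ y) = (E.s a * x) ⊗ᵇ y := rfl

@[simp]
theorem leftS_tmul (a : A) (x y : U) : E.leftS a (x ⊗ᵇ y) = (E.s a * x) ⊗ᵇ y := rfl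

/-- `x ⊗ y ↦ x ⊗ y z` on `▶U ⊗_{Aᵒᵖ} U_◁`. -/
def opMulRight (z : U) : Module.End k E.OpTensor :=
  BalTensor.map LinearMap.id (LinearMap.mulRight k z) (fun _ _ => rfl)
    (fun a m => by simp [mul_assoc])

@[simp]
theorem opMulRight_tmul (z x y : U) : E.opMulRight z (x ⊗ᵇ y) = x ⊗ᵇ (y * z) := rfl

/-- `x ⊗ y ↦ x s(a) ⊗ y` on `▶U ⊗_{Aᵒᵖ} U_◁`. -/
def opMulS (a : A) : Module.End k E.OpTensor :=
  BalTensor.map (LinearMap.mulRight k (E.s a)) LinearMap.id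
    (fun b m => by simp [mul_assoc, E.comm]) (fun _ _ => rfl)

@[simp]
theorem opMulS_tmul (a : A) (x y : U) : E.opMulS a (x ⊗ᵇ y) = (x * E.s a) ⊗ᵇ y := rfl

/-- `x ⊗ y ↦ t(a) x ⊗ y` on `▶U ⊗_{Aᵒᵖ} U_◁`. -/
def opTMul (a : A) : Module.End k E.OpTensor :=
  BalTensor.map (LinearMap.mulLeft k (E.t (op a))) LinearMap.id
    (fun b m => by simp [mul_assoc]) (fun _ _ => rfl)

@[simp]
theorem opTMul_tmul (a : A) (x y : U) : E.opTMul a (x ⊗ᵇ y) = (E.t (op a) * x) ⊗ᵇ y := rfl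

/-- `x ⊗ y ↦ x ⊗ y z` on `R_◁ ⊗_A ▹U`. -/
def mulRightSnd : U →ₗ[k] Module.End k (WTensor t E.s) where
  toFun z := BalTensor.map LinearMap.id (LinearMap.mulRight k z) (fun _ _ => rfl)
    (fun a m => by simp [mul_assoc])
  map_add' z z' := BalTensor.ext fun x y =>
    (congrArg (x ⊗ᵇ ·) (mul_add y z z')).trans (BalTensor.tmul_add x _ _)
  map_smul' c z := BalTensor.ext fun x y =>
    (congrArg (x ⊗ᵇ ·) (mul_smul_comm c y z)).trans (BalTensor.tmul_smul c x _)

@[simp]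
theorem mulRightSnd_tmul (z : U) (x : R) (y : U) :
    E.mulRightSnd t z (x ⊗ᵇ y) = x ⊗ᵇ (y * z) := rfl

/-- `x ⊗ y ↦ x ⊗ t(a) y` on `R_◁ ⊗_A ▹U`. -/
def tMulSnd (a : A) : Module.End k (WTensor t E.s) :=
  BalTensor.map LinearMap.id (LinearMap.mulLeft k (E.t (op a))) (fun _ _ => rfl)
    (fun b m => by simp [← mul_assoc, E.comm])

@[simp]
theorem tMulSnd_tmul (a : A) (x : R) (y : U) :
    E.tMulSnd t a (x ⊗ᵇ y) = x ⊗ᵇ (E.t (op a) * y) := rfl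

/-- `x ⊗ y ↦ x s(a) ⊗ y` on `U_◁ ⊗_A ▹U`. -/
def mulSFst (a : A) : Module.End k E.Tensor :=
  BalTensor.map (LinearMap.mulRight k (E.s a)) LinearMap.id
    (fun b m => by simp [mul_assoc]) (fun _ _ => rfl)

@[simp]
theorem mulSFst_tmul (a : A) (x y : U) : E.mulSFst a (x ⊗ᵇ y) = (x * E.s a) ⊗ᵇ y := rfl

/-- `x ⊗ (y ⊗ y') ↦ x ⊗ (y ⊗ y' z)` on `R_◁ ⊗_A ▹U_◁ ⊗_A ▹U`. -/
def mulRightLast (z : U) : Module.End k (E.Tensor3 t) :=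
  BalTensor.map LinearMap.id (E.mulRightSnd E.t z) (fun _ _ => rfl) (fun a X => by
    obtain ⟨n, x, y, rfl⟩ := BalTensor.exists_rep X
    simp)

@[simp]
theorem mulRightLast_tmul (z : U) (x : R) (Y : E.Tensor) :
    E.mulRightLast t z (x ⊗ᵇ Y) = x ⊗ᵇ E.mulRightSnd E.t z Y := rfl

theorem mulRightLast_mkTensor3 (z y : U) (X : WTensor t E.s) :
    E.mulRightLast t z (E.mkTensor3 t X y) = E.mkTensor3 t X (y * z) := by
  obtain ⟨n, x, x', rfl⟩ := BalTensor.exists_rep X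
  simp

variable {t}

/-- `δ ⊗_A U`, that is `x ⊗ y ↦ x₍₀₎ ⊗ (x₍₁₎ ⊗ y)`, for a right `A`-linear map
`δ : R → R_◁ ⊗_A ▹U`. -/
def coactId (δ : R →ₗ[k] WTensor t E.s)
    (hδ : ∀ a x, δ (t (op a) * x) = E.tMulSnd t a (δ x)) :
    WTensor t E.s →ₗ[k] E.Tensor3 t :=
  BalTensor.lift (E.mkTensor3 t ∘ₗ δ) fun a x y => by
    obtain ⟨n, x', x'', h⟩ := BalTensor.exists_rep (δ x)
    simp [hδ, h, WTensor.t_mul_tmul]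

@[simp]
theorem coactId_tmul (δ : R →ₗ[k] WTensor t E.s)
    (hδ : ∀ a x, δ (t (op a) * x) = E.tMulSnd t a (δ x)) (x : R) (y : U) :
    E.coactId δ hδ (x ⊗ᵇ y) = E.mkTensor3 t (δ x) y := rfl

end EnvRing

end EnvRing

namespace LeftBialgebroid

variable {k A U : Type*} [CommRing k] [Ring A] [Algebra k A] [Ring U] [Algebra k U]
variable (ℬ : LeftBialgebroid k A U)

theorem comul_s_mul (a : A) (u : U) : ℬ.comul (ℬ.s a * u) = ℬ.leftS a (ℬ.comul u) := by
  obtain ⟨n, x, y, h⟩ := BalTensor.exists_rep (ℬ.comul u)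
  simpa [h] using ℬ.comul_actions 1 a 1 1 u x y h

theorem comul_t_mul (a : A) (u : U) :
    ℬ.comul (ℬ.t (op a) * u) = ℬ.tMulSnd ℬ.t a (ℬ.comul u) := by
  obtain ⟨n, x, y, h⟩ := BalTensor.exists_rep (ℬ.comul u)
  simpa [h] using ℬ.comul_actions 1 1 a 1 u x y h

theorem comul_mul_s (a : A) (u : U) : ℬ.comul (u * ℬ.s a) = ℬ.mulSFst a (ℬ.comul u) := by
  obtain ⟨n, x, y, h⟩ := BalTensor.exists_rep (ℬ.comul u)
  simpa [h] using ℬ.comul_actions 1 1 1 a u x y h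

theorem comul_mul_t (a : A) (u : U) :
    ℬ.comul (u * ℬ.t (op a)) = ℬ.mulRightSnd ℬ.t (ℬ.t (op a)) (ℬ.comul u) := by
  obtain ⟨n, x, y, h⟩ := BalTensor.exists_rep (ℬ.comul u)
  simpa [h] using ℬ.comul_actions a 1 1 1 u x y h

theorem counit_s_mul (a : A) (u : U) : ℬ.counit (ℬ.s a * u) = a * ℬ.counit u := by
  simpa using ℬ.counit_white a 1 u

theorem counit_t_mul (a : A) (u : U) : ℬ.counit (ℬ.t (op a) * u) = ℬ.counit u * a := by
  simpa using ℬ.counit_white 1 a u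

/-- `Δ ⊗_A U` on `U_◁ ⊗_A ▹U`. -/
abbrev comulId : ℬ.Tensor →ₗ[k] ℬ.Tensor3 ℬ.t :=
  ℬ.coactId ℬ.comul ℬ.comul_t_mul

variable {R : Type*} [Ring R] [Algebra k R] (t : Aᵐᵒᵖ →ₐ[k] R)

/-- `R ⊗_A Δ` on `R_◁ ⊗_A ▹U`. -/
def idComul : WTensor t ℬ.s →ₗ[k] ℬ.Tensor3 t :=
  BalTensor.map LinearMap.id ℬ.comul (fun _ _ => rfl) (fun a v => ℬ.comul_s_mul a v)

@[simp]
theorem idComul_tmul (x : R) (v : U) : ℬ.idComul t (x ⊗ᵇ v) = x ⊗ᵇ ℬ.comul v := rfl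

theorem comulId_comul (u : U) : ℬ.comulId (ℬ.comul u) = ℬ.idComul ℬ.t (ℬ.comul u) := by
  obtain ⟨n, x, y, h⟩ := BalTensor.exists_rep (ℬ.comul u)
  obtain ⟨m, x', x'', hx⟩ := BalTensor.exists_rep_family fun i => ℬ.comul (x i)
  simpa [h, hx] using ℬ.coassoc u x y x' x'' h hx

/-- `r ⊗ y ↦ t(ε(y)) r` on `R_◁ ⊗_A ▹U`. -/
def counitRight : WTensor t ℬ.s →ₗ[k] R :=
  BalTensor.lift
    ((LinearMap.mul k R).flip.compl₂ (t.toLinearMap ∘ₗ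
      (MulOpposite.opLinearEquiv k).toLinearMap ∘ₗ ℬ.counit))
    (fun a r y => by simp [ℬ.counit_s_mul, mul_assoc])

@[simp]
theorem counitRight_tmul (r : R) (y : U) :
    ℬ.counitRight t (r ⊗ᵇ y) = t (op (ℬ.counit y)) * r := rfl

theorem counitRight_mapFst {R' : Type*} [Ring R'] [Algebra k R'] {t' : Aᵐᵒᵖ →ₐ[k] R'}
    (f : R →ₗ[k] R') (hf : ∀ a x, f (t (op a) * x) = t' (op a) * f x) (X : WTensor t ℬ.s) :
    ℬ.counitRight t' (mapFst f hf X) = f (ℬ.counitRight t X) := by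
  obtain ⟨n, x, y, rfl⟩ := BalTensor.exists_rep X
  simp [hf]

theorem counitRight_comul (u : U) : ℬ.counitRight ℬ.t (ℬ.comul u) = u := by
  obtain ⟨n, x, y, h⟩ := BalTensor.exists_rep (ℬ.comul u)
  simpa [h] using ℬ.comul_counit u x y h

theorem counitRight_tMulSnd (a : A) (X : WTensor t ℬ.s) :
    ℬ.counitRight t (ℬ.tMulSnd t a X) = t (op a) * ℬ.counitRight t X := by
  obtain ⟨n, x, y, rfl⟩ := BalTensor.exists_rep X
  simp [ℬ.counit_t_mul, Finset.mul_sum, mul_assoc]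

theorem counitRight_blackLeft (a : A) (X : WTensor t ℬ.s) :
    ℬ.counitRight t (blackLeft t ℬ.s a X) = ℬ.counitRight t X * t (op a) := by
  obtain ⟨n, x, y, rfl⟩ := BalTensor.exists_rep X
  simp [Finset.sum_mul, mul_assoc]

end LeftBialgebroid

namespace LeftHopfAlgebroid

variable {k A U : Type*} [CommRing k] [Ring A] [Algebra k A] [Ring U] [Algebra k U]
variable (𝒰 : LeftHopfAlgebroid k A U)

theorem galois_tmul_eq (u v : U) : 𝒰.galois (u ⊗ᵇ v) = 𝒰.mulRightSnd 𝒰.t v (𝒰.comul u) := by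
  obtain ⟨n, x, y, h⟩ := BalTensor.exists_rep (𝒰.comul u)
  simp [𝒰.galois_tmul u v x y h, h]

/-- The translation map as a linear map. -/
def translationL : U →ₗ[k] 𝒰.OpTensor :=
  𝒰.galois.symm.toLinearMap ∘ₗ (BalTensor.mk _ _).flip 1

@[simp]
theorem translationL_apply (u : U) : 𝒰.translationL u = 𝒰.translation u := rfl

@[simp]
theorem galois_translation (u : U) : 𝒰.galois (𝒰.translation u) = u ⊗ᵇ 1 :=
  𝒰.galois.apply_symm_apply _

theorem galois_opMulRight (z : U) (X : 𝒰.OpTensor) :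
    𝒰.galois (𝒰.opMulRight z X) = 𝒰.mulRightSnd 𝒰.t z (𝒰.galois X) := by
  obtain ⟨n, u, v, rfl⟩ := BalTensor.exists_rep X
  choose m x y h using fun i => BalTensor.exists_rep (𝒰.comul (u i))
  simp [galois_tmul_eq, h, mul_assoc]

theorem galois_opLeftS (a : A) (X : 𝒰.OpTensor) :
    𝒰.galois (𝒰.opLeftS a X) = 𝒰.leftS a (𝒰.galois X) := by
  obtain ⟨n, u, v, rfl⟩ := BalTensor.exists_rep X
  choose m x y h using fun i => BalTensor.exists_rep (𝒰.comul (u i))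
  simp [galois_tmul_eq, 𝒰.comul_s_mul, h]

theorem galois_opMulS (a : A) (X : 𝒰.OpTensor) :
    𝒰.galois (𝒰.opMulS a X) = 𝒰.mulSFst a (𝒰.galois X) := by
  obtain ⟨n, u, v, rfl⟩ := BalTensor.exists_rep X
  choose m x y h using fun i => BalTensor.exists_rep (𝒰.comul (u i))
  simp [galois_tmul_eq, 𝒰.comul_mul_s, h]

theorem galois_opTMul (a : A) (X : 𝒰.OpTensor) :
    𝒰.galois (𝒰.opTMul a X) = 𝒰.tMulSnd 𝒰.t a (𝒰.galois X) := by
  obtain ⟨n, u, v, rfl⟩ := BalTensor.exists_rep X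
  choose m x y h using fun i => BalTensor.exists_rep (𝒰.comul (u i))
  simp [galois_tmul_eq, 𝒰.comul_t_mul, h, mul_assoc]

theorem galois_symm_tmul (u z : U) :
    𝒰.galois.symm (u ⊗ᵇ z) = 𝒰.opMulRight z (𝒰.translation u) :=
  𝒰.galois.injective (by simp [galois_opMulRight])

theorem galois_symm_comul (u : U) : 𝒰.galois.symm (𝒰.comul u) = u ⊗ᵇ 1 := by
  obtain ⟨n, x, y, h⟩ := BalTensor.exists_rep (𝒰.comul u)
  exact 𝒰.galois.injective (by simp [galois_tmul_eq, h])

theorem translation_s_mul (a : A) (u : U) :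
    𝒰.translation (𝒰.s a * u) = 𝒰.opLeftS a (𝒰.translation u) :=
  𝒰.galois.injective (by simp [galois_opLeftS])

theorem translation_t_mul (a : A) (u : U) :
    𝒰.translation (𝒰.t (op a) * u) = 𝒰.opMulRight (𝒰.s a) (𝒰.translation u) :=
  𝒰.galois.injective (by simp [galois_opMulRight, WTensor.t_mul_tmul])

theorem translation_mul_s (a : A) (u : U) :
    𝒰.translation (u * 𝒰.s a) = 𝒰.opMulS a (𝒰.translation u) :=
  𝒰.galois.injective (by simp [galois_opMulS])

theorem opTMul_translation (a : A) (u : U) :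
    𝒰.opTMul a (𝒰.translation u) = 𝒰.opMulRight (𝒰.t (op a)) (𝒰.translation u) :=
  𝒰.galois.injective (by simp [galois_opMulRight, galois_opTMul])

section OpMul

variable {R : Type*} [Ring R] [Algebra k R] (ρ : U →ₐ[k] R)

/-- `x ⊗ y ↦ f(x) ρ(y)` on `▶U ⊗_{Aᵒᵖ} U_◁`. -/
def opMul (f : U →ₗ[k] R) (hf : ∀ a x, f (x * 𝒰.t (op a)) = f x * ρ (𝒰.t (op a))) :
    𝒰.OpTensor →ₗ[k] R :=
  BalTensor.lift ((LinearMap.mul k R).compl₁₂ f ρ.toLinearMap)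
    (fun a x y => by simp [hf, mul_assoc])

@[simp]
theorem opMul_tmul (f : U →ₗ[k] R) (hf : ∀ a x, f (x * 𝒰.t (op a)) = f x * ρ (𝒰.t (op a)))
    (x y : U) : 𝒰.opMul ρ f hf (x ⊗ᵇ y) = f x * ρ y := rfl

/-- `x ⊗ y ↦ ρ(s(ε(x)) y)` on `U_◁ ⊗_A ▹U`. -/
def counitLeft : 𝒰.Tensor →ₗ[k] R :=
  BalTensor.lift ((LinearMap.mul k R).compl₁₂
    (ρ.toLinearMap ∘ₗ 𝒰.s.toLinearMap ∘ₗ 𝒰.counit) ρ.toLinearMap)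
    (fun a x y => by simp [𝒰.counit_t_mul, mul_assoc])

@[simp]
theorem counitLeft_tmul (x y : U) :
    𝒰.counitLeft ρ (x ⊗ᵇ y) = ρ (𝒰.s (𝒰.counit x)) * ρ y := rfl

theorem mul_counitLeft_galois (r : R) (X : 𝒰.OpTensor) :
    r * 𝒰.counitLeft ρ (𝒰.galois X) =
      𝒰.opMul ρ (LinearMap.mulLeft k r ∘ₗ ρ.toLinearMap) (fun _ _ => by simp [mul_assoc]) X := by
  induction X using BalTensor.induction_on with
  | zero => simp
  | tmul u v =>
    obtain ⟨n, x, y, h⟩ := BalTensor.exists_rep (𝒰.comul u)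
    calc r * 𝒰.counitLeft ρ (𝒰.galois (u ⊗ᵇ v))
        = r * ρ (∑ i, 𝒰.s (𝒰.counit (x i)) * y i) * ρ v := by
          simp [galois_tmul_eq, h, Finset.sum_mul, mul_assoc]
      _ = _ := by simp [𝒰.counit_comul u x y h]
  | add X Y hX hY => simp [mul_add, hX, hY]

/-- `r u₊ u₋ = r s(ε(u))`. -/
theorem opMul_mulLeft_translation (r : R) (u : U) :
    𝒰.opMul ρ (LinearMap.mulLeft k r ∘ₗ ρ.toLinearMap) (fun _ _ => by simp [mul_assoc])
      (𝒰.translation u) = r * ρ (𝒰.s (𝒰.counit u)) := by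
  simp [← mul_counitLeft_galois]

end OpMul

variable {R : Type*} [Ring R] [Algebra k R] (t : Aᵐᵒᵖ →ₐ[k] R)

/-- `x ⊗ u ↦ x ⊗ (u₊ ⊗ u₋)`. -/
def idTranslation : WTensor t 𝒰.s →ₗ[k] 𝒰.MixedOver t :=
  BalTensor.map LinearMap.id 𝒰.translationL (fun _ _ => rfl)
    (fun a u => 𝒰.translation_s_mul a u)

@[simp]
theorem idTranslation_tmul (x : R) (y : U) :
    𝒰.idTranslation t (x ⊗ᵇ y) = x ⊗ᵇ 𝒰.translation y := rfl

/-- `u ⊗ z ↦ u₍₁₎ ⊗ (u₍₂₎ ⊗ z)`. -/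
def comulMixed : 𝒰.OpTensor →ₗ[k] 𝒰.MixedTensor :=
  BalTensor.lift (𝒰.mkMixed 𝒰.t ∘ₗ 𝒰.comul) fun a u z => by
    obtain ⟨n, x, y, h⟩ := BalTensor.exists_rep (𝒰.comul u)
    simp [𝒰.comul_mul_t, h, EnvRing.OpTensor.mul_t_tmul]

@[simp]
theorem comulMixed_tmul (u z : U) :
    𝒰.comulMixed (u ⊗ᵇ z) = 𝒰.mkMixed 𝒰.t (𝒰.comul u) z := rfl

/-- `U ⊗_A β` for the Hopf-Galois map `β`. -/
def idGalois : 𝒰.MixedTensor →ₗ[k] 𝒰.Tensor3 𝒰.t :=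
  BalTensor.map (LinearEquiv.refl k U).toLinearMap 𝒰.galois.toLinearMap (fun _ _ => rfl)
    (fun a X => 𝒰.galois_opLeftS a X)

theorem idGalois_injective : Function.Injective 𝒰.idGalois :=
  BalTensor.map_injective (LinearEquiv.refl k U) 𝒰.galois _ _

@[simp]
theorem idGalois_tmul (x : U) (Y : 𝒰.OpTensor) : 𝒰.idGalois (x ⊗ᵇ Y) = x ⊗ᵇ 𝒰.galois Y := rfl

theorem idGalois_comulMixed (X : 𝒰.OpTensor) :
    𝒰.idGalois (𝒰.comulMixed X) = 𝒰.comulId (𝒰.galois X) := by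
  induction X using BalTensor.induction_on with
  | zero => simp
  | tmul u z =>
    obtain ⟨n, x, y, h⟩ := BalTensor.exists_rep (𝒰.comul u)
    have key := congrArg (𝒰.mulRightLast 𝒰.t z) (𝒰.comulId_comul u)
    simp only [h, map_sum, EnvRing.coactId_tmul, EnvRing.mulRightLast_mkTensor3,
      LeftBialgebroid.idComul_tmul, EnvRing.mulRightLast_tmul] at key
    simp [galois_tmul_eq, h, key]
  | add X Y hX hY => simp [hX, hY]

/-- `u₍₁₎ ⊗ u₍₂₎₊ ⊗ u₍₂₎₋ = u₊₍₁₎ ⊗ u₊₍₂₎ ⊗ u₋`. -/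
theorem idTranslation_comul (u : U) :
    𝒰.idTranslation 𝒰.t (𝒰.comul u) = 𝒰.comulMixed (𝒰.translation u) := by
  apply 𝒰.idGalois_injective
  rw [idGalois_comulMixed, galois_translation, EnvRing.coactId_tmul]
  obtain ⟨n, x, y, h⟩ := BalTensor.exists_rep (𝒰.comul u)
  simp [h]

end LeftHopfAlgebroid

/-! ### Dual bases and contraction -/

namespace EnvRing

/-- A dual basis of the left `Aᵒᵖ`-module `U_◁`, indexed by `U` itself. -/
structure DualBasis {k A U : Type*} [CommRing k] [Ring A] [Algebra k A]
    [Ring U] [Algebra k U] (E : EnvRing k A U) where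
  coord : U →ₗ[k] U →₀ Aᵐᵒᵖ
  coord_t_mul : ∀ a z, coord (E.t a * z) = a • coord z
  sum_coord : ∀ z, (coord z).sum (fun e a => E.t a * e) = z

variable {k A U R : Type*} [CommRing k] [Ring A] [Algebra k A] [Ring U] [Algebra k U]
  [Ring R] [Algebra k R]

theorem WhiteRightProjective.nonempty_dualBasis {E : EnvRing k A U}
    (h : E.WhiteRightProjective) : Nonempty E.DualBasis := by
  let : Module Aᵐᵒᵖ U := Module.compHom U (E.t : Aᵐᵒᵖ →+* U)
  have smul_eq (a : Aᵐᵒᵖ) (z : U) : a • z = E.t a * z := rfl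
  obtain ⟨f, hf⟩ := h.out
  refine ⟨⟨⟨⟨f, map_add f⟩, fun c z => ?_⟩, fun a z => f.map_smul a z, hf⟩⟩
  have hc : c • z = algebraMap k Aᵐᵒᵖ c • z := by
    rw [smul_eq, AlgHom.commutes, Algebra.smul_def]
  have key := f.map_smul (algebraMap k Aᵐᵒᵖ c) z
  rwa [← hc, algebraMap_smul] at key

variable (E : EnvRing k A U) (t : Aᵐᵒᵖ →ₐ[k] R)

section MixedOver

/-- `x ⊗ Y ↦ x t(a) ⊗ Y`. -/
def mixedMulT (a : A) : Module.End k (E.MixedOver t) :=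
  BalTensor.map (LinearMap.mulRight k (t (op a))) LinearMap.id
    (fun b m => by simp [mul_assoc]) (fun _ _ => rfl)

@[simp]
theorem mixedMulT_tmul (a : A) (x : R) (Y : E.OpTensor) :
    E.mixedMulT t a (x ⊗ᵇ Y) = (x * t (op a)) ⊗ᵇ Y := rfl

/-- `x ⊗ (y ⊗ z) ↦ x ⊗ (y s(a) ⊗ z)`. -/
def mixedMulS (a : A) : Module.End k (E.MixedOver t) :=
  BalTensor.map LinearMap.id (E.opMulS a) (fun _ _ => rfl) (fun b X => by
    obtain ⟨n, x, y, rfl⟩ := BalTensor.exists_rep X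
    simp [mul_assoc])

@[simp]
theorem mixedMulS_tmul (a : A) (x : R) (Y : E.OpTensor) :
    E.mixedMulS t a (x ⊗ᵇ Y) = x ⊗ᵇ E.opMulS a Y := rfl

/-- `x ⊗ (y ⊗ z) ↦ x ⊗ (t(a) y ⊗ z)`. -/
def mixedTMul (a : A) : Module.End k (E.MixedOver t) :=
  BalTensor.map LinearMap.id (E.opTMul a) (fun _ _ => rfl) (fun b X => by
    obtain ⟨n, x, y, rfl⟩ := BalTensor.exists_rep X
    simp [← mul_assoc, E.comm])

@[simp]
theorem mixedTMul_tmul (a : A) (x : R) (Y : E.OpTensor) :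
    E.mixedTMul t a (x ⊗ᵇ Y) = x ⊗ᵇ E.opTMul a Y := rfl

/-- `x ⊗ (y ⊗ z) ↦ x ⊗ (y ⊗ z w)`. -/
def mixedMulRight (w : U) : Module.End k (E.MixedOver t) :=
  BalTensor.map LinearMap.id (E.opMulRight w) (fun _ _ => rfl) (fun b X => by
    obtain ⟨n, x, y, rfl⟩ := BalTensor.exists_rep X
    simp)

@[simp]
theorem mixedMulRight_tmul (w : U) (x : R) (Y : E.OpTensor) :
    E.mixedMulRight t w (x ⊗ᵇ Y) = x ⊗ᵇ E.opMulRight w Y := rfl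

variable {t}

theorem mixedTMul_mkMixed (a : A) (X : WTensor t E.s) (z : U) :
    E.mixedTMul t a (E.mkMixed t X z) = E.mkMixed t (E.tMulSnd t a X) z := by
  obtain ⟨n, x, y, rfl⟩ := BalTensor.exists_rep X
  simp

theorem mixedMulRight_mkMixed (w : U) (X : WTensor t E.s) (z : U) :
    E.mixedMulRight t w (E.mkMixed t X z) = E.mkMixed t X (z * w) := by
  obtain ⟨n, x, y, rfl⟩ := BalTensor.exists_rep X
  simp

variable {E} in
theorem _root_.Bialgd.IsTakeuchi.tMulSnd {X : WTensor t E.s} (hX : IsTakeuchi X) (a : A) :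
    IsTakeuchi (E.tMulSnd t a X) := by
  intro b
  have h := congrArg (E.tMulSnd t a) (hX b)
  obtain ⟨n, x, v, rfl⟩ := BalTensor.exists_rep X
  simpa [mul_assoc] using h

/-- The Takeuchi condition on the first two factors of `R_◁ ⊗_A (▹▶U ⊗_{Aᵒᵖ} U_◁)`. For projective
`U_◁` it says that `X` comes from `(R ×_A U) ⊗_{Aᵒᵖ} U`. -/
def IsMixedTakeuchi (X : E.MixedOver t) : Prop :=
  ∀ a, E.mixedMulT t a X = E.mixedMulS t a X

end MixedOver

namespace DualBasis

variable {E} (D : E.DualBasis)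

/-- The coordinates `y ⊗ z ↦ (y t(fₑ(z)))ₑ` of `▶U ⊗_{Aᵒᵖ} U_◁`. -/
def expandOp : E.OpTensor →ₗ[k] U →₀ U :=
  BalTensor.lift
    (LinearMap.mk₂ k
      (fun y z => Finsupp.mapRange.linearMap (LinearMap.mulLeft k y ∘ₗ E.t.toLinearMap)
        (D.coord z))
      (fun y y' z => by ext e; simp [add_mul])
      (fun c y z => by ext e; simp)
      (fun y z z' => by simp only [map_add])
      (fun c y z => by simp only [map_smul]))
    (fun a y z => by ext e; simp [D.coord_t_mul])

@[simp]
theorem expandOp_tmul_apply (y z e : U) :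
    D.expandOp (y ⊗ᵇ z) e = y * E.t (D.coord z e) := by
  simp [expandOp]

/-- The coordinates `x ⊗ (y ⊗ z) ↦ (x ⊗ y t(fₑ(z)))ₑ` of `R_◁ ⊗_A (▹▶U ⊗_{Aᵒᵖ} U_◁)`. -/
def expand : E.MixedOver t →ₗ[k] U →₀ WTensor t E.s :=
  BalTensor.lift
    (LinearMap.mk₂ k
      (fun x Y => Finsupp.mapRange.linearMap (BalTensor.mk _ _ x) (D.expandOp Y))
      (fun x x' Y => by ext e; simp)
      (fun c x Y => by ext e; simp)
      (fun x Y Y' => by simp only [map_add])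
      (fun c x Y => by simp only [map_smul]))
    (fun a x Y => by
      obtain ⟨n, y, z, rfl⟩ := BalTensor.exists_rep Y
      ext e
      simp [Finsupp.finsetSum_apply, WTensor.t_mul_tmul, mul_assoc])

@[simp]
theorem expand_tmul_tmul_apply (x : R) (y z e : U) :
    D.expand t (x ⊗ᵇ (y ⊗ᵇ z)) e = x ⊗ᵇ (y * E.t (D.coord z e)) := by
  simp [expand]

theorem expand_mkMixed (X : WTensor t E.s) (z : U) :
    D.expand t (E.mkMixed t X z) =
      (D.coord z).mapRange (fun a => E.mulRightSnd t (E.t a) X) (by simp) := by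
  obtain ⟨n, x, y, rfl⟩ := BalTensor.exists_rep X
  ext e
  simp [Finsupp.finsetSum_apply]

theorem sum_expand (X : E.MixedOver t) :
    (D.expand t X).sum (fun e Y => E.mkMixed t Y e) = X := by
  suffices Finsupp.lsum k (fun e => (E.mkMixed t).flip e) ∘ₗ D.expand t = LinearMap.id from
    LinearMap.congr_fun this X
  refine BalTensor.ext_nested fun x y z => ?_
  have key : D.expand t (x ⊗ᵇ (y ⊗ᵇ z)) = _ := D.expand_mkMixed t (x ⊗ᵇ y) z
  have tmul_e (e : U) (a : Aᵐᵒᵖ) :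
      (x ⊗ᵇ ((y * E.t a) ⊗ᵇ e) : E.MixedOver t) = x ⊗ᵇ (y ⊗ᵇ (E.t a * e)) :=
    congrArg (x ⊗ᵇ ·) (OpTensor.mul_t_tmul E a.unop y e)
  rw [LinearMap.comp_apply, key, Finsupp.lsum_apply, Finsupp.sum_mapRange_index (by simp)]
  simp only [LinearMap.flip_apply, mulRightSnd_tmul, mkMixed_tmul, tmul_e, Finsupp.sum]
  rw [← BalTensor.tmul_sum, ← BalTensor.tmul_sum]
  exact congrArg (fun z' => x ⊗ᵇ (y ⊗ᵇ z')) (D.sum_coord z)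

variable {t}

theorem isTakeuchi_expand {X : E.MixedOver t} (hX : E.IsMixedTakeuchi X) (e : U) :
    IsTakeuchi (D.expand t X e) := by
  intro a
  have h := DFunLike.congr_fun (congrArg (D.expand t) (hX a)) e
  obtain ⟨n, x, y, z, rfl⟩ := BalTensor.exists_rep_nested X
  have comm (b : Aᵐᵒᵖ) : E.t b * E.s a = E.s a * E.t b := (E.comm a b.unop).symm
  simpa [Finsupp.finsetSum_apply, mul_assoc, comm] using h

end DualBasis

theorem _root_.Bialgd.exists_finsupp_sum_eq {ι M N : Type*} [Zero M] [AddCommMonoid N]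
    (f : ι →₀ M) (g : ι → M → N) :
    ∃ e : Fin f.support.card → ι, f.sum g = ∑ j, g (e j) (f (e j)) := by
  refine ⟨fun j => f.support.equivFin.symm j, ?_⟩
  rw [Finsupp.sum, ← Finset.sum_coe_sort, ← f.support.equivFin.symm.sum_comp]

/-- An element satisfying the Takeuchi condition lifts to `(R ×_A U) ⊗_{Aᵒᵖ} U`. -/
theorem IsMixedTakeuchi.exists_eq_sum {E : EnvRing k A U} (D : E.DualBasis)
    {t : Aᵐᵒᵖ →ₐ[k] R} {X : E.MixedOver t} (hX : E.IsMixedTakeuchi X) :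
    ∃ (n : ℕ) (Y : Fin n → WTensor t E.s) (z : Fin n → U),
      (∀ j, IsTakeuchi (Y j)) ∧ X = ∑ j, E.mkMixed t (Y j) (z j) := by
  obtain ⟨z, hz⟩ := exists_finsupp_sum_eq (D.expand t X) fun e Y => E.mkMixed t Y e
  exact ⟨_, fun j => D.expand t X (z j), z, fun j => D.isTakeuchi_expand hX (z j),
    (D.sum_expand t X).symm.trans hz⟩

end EnvRing

namespace LeftBialgebroid

variable {k A U R : Type*} [CommRing k] [Ring A] [Algebra k A] [Ring U] [Algebra k U]
  [Ring R] [Algebra k R]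
variable (ℬ : LeftBialgebroid k A U) (D : ℬ.DualBasis) (t : Aᵐᵒᵖ →ₐ[k] R) (ρ : U →ₐ[k] R)

/-- The contraction `x ⊗ (y ⊗ z) ↦ t(ε(y)) x ρ(z)` on the image of `(R ×_A U) ⊗_{Aᵒᵖ} U`, where it
does not depend on the dual basis used to extend it to `R_◁ ⊗_A (▹▶U ⊗_{Aᵒᵖ} U_◁)`. -/
def contraction : ℬ.MixedOver t →ₗ[k] R :=
  Finsupp.lsum k (fun e => LinearMap.mulRight k (ρ e) ∘ₗ ℬ.counitRight t) ∘ₗ D.expand t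

variable {t ρ} (ht : ∀ a, ρ (ℬ.t a) = t a)
include ht

theorem contraction_mkMixed {X : WTensor t ℬ.s} (hX : IsTakeuchi X) (z : U) :
    ℬ.contraction D t ρ (ℬ.mkMixed t X z) = ℬ.counitRight t X * ρ z := by
  have counit_mul_t (a : Aᵐᵒᵖ) :
      ℬ.counitRight t (ℬ.mulRightSnd t (ℬ.t a) X) = ℬ.counitRight t X * t a :=
    calc ℬ.counitRight t (ℬ.mulRightSnd t (ℬ.t a) X)
        = ℬ.counitRight t (blackRight t ℬ.s a.unop X) := by
          obtain ⟨n, x, y, rfl⟩ := BalTensor.exists_rep X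
          simp [← ℬ.counit_black]
      _ = ℬ.counitRight t X * t a := by
          rw [← hX, counitRight_blackLeft, MulOpposite.op_unop]
  calc ℬ.contraction D t ρ (ℬ.mkMixed t X z)
      = (D.coord z).sum fun e a => ℬ.counitRight t X * ρ (ℬ.t a * e) := by
        simp [contraction, D.expand_mkMixed, Finsupp.sum_mapRange_index, counit_mul_t, ht,
          mul_assoc]
    _ = ℬ.counitRight t X * ρ z := by
        conv_rhs => rw [← D.sum_coord z]
        simp only [Finsupp.sum, map_sum, Finset.mul_sum]

theorem contraction_mixedMulRight {X : ℬ.MixedOver t} (hX : ℬ.IsMixedTakeuchi X) (w : U) :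
    ℬ.contraction D t ρ (ℬ.mixedMulRight t w X) = ℬ.contraction D t ρ X * ρ w := by
  obtain ⟨n, Y, z, hY, rfl⟩ := hX.exists_eq_sum D
  simp [EnvRing.mixedMulRight_mkMixed, ℬ.contraction_mkMixed D ht (hY _), Finset.sum_mul,
    mul_assoc]

theorem contraction_mixedTMul {X : ℬ.MixedOver t} (hX : ℬ.IsMixedTakeuchi X) (a : A) :
    ℬ.contraction D t ρ (ℬ.mixedTMul t a X) = t (op a) * ℬ.contraction D t ρ X := by
  obtain ⟨n, Y, z, hY, rfl⟩ := hX.exists_eq_sum D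
  simp [EnvRing.mixedTMul_mkMixed, ℬ.contraction_mkMixed D ht (hY _),
    ℬ.contraction_mkMixed D ht ((hY _).tMulSnd a), counitRight_tMulSnd, Finset.mul_sum,
    mul_assoc]

theorem contraction_mapFst_mul {X : ℬ.MixedOver t} (hX : ℬ.IsMixedTakeuchi X) (r : R)
    (hr : ∀ a x, LinearMap.mulLeft k r (t (op a) * x) = t (op a) * LinearMap.mulLeft k r x) :
    ℬ.contraction D t ρ (mapFst (LinearMap.mulLeft k r) hr X) = r * ℬ.contraction D t ρ X := by
  obtain ⟨n, Y, z, hY, rfl⟩ := hX.exists_eq_sum D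
  have hY' j := (hY j).mapFst (LinearMap.mulLeft k r) hr (fun a x => (mul_assoc r x _).symm)
  simp [EnvRing.mapFst_mkMixed, ℬ.contraction_mkMixed D ht (hY _),
    ℬ.contraction_mkMixed D ht (hY' _), counitRight_mapFst, Finset.mul_sum, mul_assoc]

end LeftBialgebroid

namespace LeftHopfAlgebroid

variable {k A U R : Type*} [CommRing k] [Ring A] [Algebra k A] [Ring U] [Algebra k U]
  [Ring R] [Algebra k R]
variable (𝒰 : LeftHopfAlgebroid k A U) (D : 𝒰.DualBasis)

section Translation

variable {t : Aᵐᵒᵖ →ₐ[k] R} {ρ : U →ₐ[k] R} (ht : ∀ a, ρ (𝒰.t a) = t a)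
  (f : U →ₗ[k] R) (hf : ∀ a x, f (𝒰.t (op a) * x) = t (op a) * f x)
  (hf' : ∀ a x, f (x * 𝒰.t (op a)) = f x * t (op a))
include ht hf

/-- `t(ε(u₍₂₎₊)) f(u₍₁₎) u₍₂₎₋ = f(u₊) u₋`. -/
theorem sum_contraction_tmul_translation {u : U} {n : ℕ} {x y : Fin n → U}
    (h : 𝒰.comul u = ∑ i, x i ⊗ᵇ y i) :
    ∑ i, 𝒰.contraction D t ρ (f (x i) ⊗ᵇ 𝒰.translation (y i)) =
      𝒰.opMul ρ f (fun a x => by rw [hf', ht]) (𝒰.translation u) := by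
  calc ∑ i, 𝒰.contraction D t ρ (f (x i) ⊗ᵇ 𝒰.translation (y i))
      = 𝒰.contraction D t ρ (mapFst f hf (𝒰.idTranslation 𝒰.t (𝒰.comul u))) := by
        rw [h, map_sum, map_sum]
        exact (map_sum (𝒰.contraction D t ρ) _ _).symm
    _ = 𝒰.opMul ρ f (fun a x => by rw [hf', ht]) (𝒰.translation u) := by
        rw [idTranslation_comul]
        obtain ⟨m, u', z, hu⟩ := BalTensor.exists_rep (𝒰.translation u)
        have hT i := (𝒰.comul_takeuchi (u' i)).mapFst f hf hf'
        simp [hu, EnvRing.mapFst_mkMixed, 𝒰.contraction_mkMixed D ht (hT _),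
          LeftBialgebroid.counitRight_mapFst, LeftBialgebroid.counitRight_comul]

end Translation

variable {𝒰} in
theorem contracts_iff_exists {X : 𝒰.MixedTensor} {c : U} :
    𝒰.Contracts X c ↔ ∃ (n : ℕ) (Y : Fin n → 𝒰.Tensor) (z : Fin n → U),
      (∀ j, IsTakeuchi (Y j)) ∧ X = ∑ j, 𝒰.mkMixed 𝒰.t (Y j) (z j) ∧
        c = ∑ j, 𝒰.counitRight 𝒰.t (Y j) * z j := by
  constructor
  · rintro ⟨m, n, x, y, z, hT, rfl, rfl⟩
    exact ⟨n, fun j => ∑ i, x i j ⊗ᵇ y i j, z, hT, by simp, by simp [Finset.sum_mul]⟩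
  · rintro ⟨n, Y, z, hY, rfl, rfl⟩
    obtain ⟨m, x, y, h⟩ := BalTensor.exists_rep_family Y
    exact ⟨m, n, fun i j => x j i, fun i j => y j i, z, fun j => h j ▸ hY j,
      by simp [h], by simp [h, Finset.sum_mul]⟩

/-- The contraction `x ⊗ (y ⊗ z) ↦ t(ε(y)) x z` of the paper, extended to all of
`U_◁ ⊗_A (▹▶U ⊗_{Aᵒᵖ} U_◁)` by means of a dual basis. -/
abbrev contract : 𝒰.MixedTensor →ₗ[k] U :=
  𝒰.contraction D 𝒰.t (AlgHom.id k U)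

theorem contracts_iff {X : 𝒰.MixedTensor} (hX : 𝒰.IsMixedTakeuchi X) (c : U) :
    𝒰.Contracts X c ↔ c = 𝒰.contract D X := by
  rw [contracts_iff_exists]
  constructor
  · rintro ⟨n, Y, z, hY, rfl, rfl⟩
    simp [𝒰.contraction_mkMixed D (ρ := AlgHom.id k U) (fun _ => rfl) (hY _)]
  · rintro rfl
    obtain ⟨n, Y, z, hY, rfl⟩ := hX.exists_eq_sum D
    exact ⟨n, Y, z, hY, rfl, by
      simp [𝒰.contraction_mkMixed D (ρ := AlgHom.id k U) (fun _ => rfl) (hY _)]⟩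

end LeftHopfAlgebroid

/-! ### The coaction along a morphism -/

namespace WTensor

variable {k A R V : Type*} [CommRing k] [Ring A] [Algebra k A] [Ring R] [Algebra k R]
  [Ring V] [Algebra k V] {t : Aᵐᵒᵖ →ₐ[k] R} {s : A →ₐ[k] V}

/-- `x ⊗ v ↦ x x' ⊗ v v'` on `R_◁ ⊗_A ▹V`. -/
def mulRight : R →ₗ[k] V →ₗ[k] Module.End k (WTensor t s) :=
  LinearMap.mk₂ k
    (fun x' v' => BalTensor.map (LinearMap.mulRight k x') (LinearMap.mulRight k v')
      (fun a m => by simp [mul_assoc]) (fun a m => by simp [mul_assoc]))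
    (fun x₁ x₂ v' => BalTensor.ext fun x v =>
      (congrArg (· ⊗ᵇ (v * v')) (mul_add x x₁ x₂)).trans (BalTensor.add_tmul _ _ _))
    (fun c x' v' => BalTensor.ext fun x v =>
      (congrArg (· ⊗ᵇ (v * v')) (mul_smul_comm c x x')).trans (BalTensor.smul_tmul _ _ _))
    (fun x' v₁ v₂ => BalTensor.ext fun x v =>
      (congrArg ((x * x') ⊗ᵇ ·) (mul_add v v₁ v₂)).trans (BalTensor.tmul_add _ _ _))
    (fun c x' v' => BalTensor.ext fun x v =>
      (congrArg ((x * x') ⊗ᵇ ·) (mul_smul_comm c v v')).trans (BalTensor.tmul_smul _ _ _))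

@[simp]
theorem mulRight_tmul (x x' : R) (v v' : V) :
    mulRight x' v' (x ⊗ᵇ v : WTensor t s) = (x * x') ⊗ᵇ (v * v') := rfl

/-- Left multiplication on `R_◁ ⊗_A ▹V` by an element of `R ×_A V`. -/
def mulLeft (X : WTensor t s) (hX : IsTakeuchi X) : Module.End k (WTensor t s) :=
  BalTensor.lift (mulRight.compr₂ (LinearMap.applyₗ X)) (fun a x v => by
    have h := congrArg (mulRight x v) (hX a)
    obtain ⟨n, y, z, rfl⟩ := BalTensor.exists_rep X
    simpa [mul_assoc] using h)

@[simp]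
theorem mulLeft_tmul (X : WTensor t s) (hX : IsTakeuchi X) (x : R) (v : V) :
    mulLeft X hX (x ⊗ᵇ v) = mulRight x v X := rfl

end WTensor

namespace LeftHopfAlgebroid.Hom

variable {k A U V : Type*} [CommRing k] [Ring A] [Algebra k A]
  [Ring U] [Algebra k U] [Ring V] [Algebra k V]
  {𝒰 : LeftHopfAlgebroid k A U} {𝒱 : LeftHopfAlgebroid k A V} (π : 𝒰.Hom 𝒱)

theorem isTakeuchi_coaction (u : U) : IsTakeuchi (π.coaction u) := by
  intro a
  have h := congrArg π.idTensor (𝒰.comul_takeuchi u a)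
  obtain ⟨n, x, y, hu⟩ := BalTensor.exists_rep (𝒰.comul u)
  simpa [π.coaction_eq hu, hu, π.hom_s] using h

theorem coaction_t_mul (a : A) (u : U) :
    π.coaction (𝒰.t (op a) * u) = 𝒱.tMulSnd 𝒰.t a (π.coaction u) := by
  obtain ⟨n, x, y, h⟩ := BalTensor.exists_rep (𝒰.comul u)
  simp [Hom.coaction, 𝒰.comul_t_mul, h, π.hom_t]

theorem coaction_one : π.coaction 1 = 1 ⊗ᵇ 1 := by
  simp [Hom.coaction, 𝒰.comul_one]

/-- The coaction as an algebra map to the endomorphisms of `U_◁ ⊗_A ▹V`: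
`u` acts by `x ⊗ v ↦ u₍₁₎ x ⊗ π(u₍₂₎) v`. -/
def coactionEnd : U →ₐ[k] Module.End k (WTensor 𝒰.t 𝒱.s) :=
  AlgHom.ofLinearMap
    { toFun := fun u => WTensor.mulLeft (π.coaction u) (π.isTakeuchi_coaction u)
      map_add' := fun u u' => BalTensor.ext fun x v => by simp
      map_smul' := fun c u => BalTensor.ext fun x v => by simp }
    (BalTensor.ext fun x v => by simp [coaction_one])
    (fun u u' => BalTensor.ext fun x v => by
      obtain ⟨n, y, z, h⟩ := BalTensor.exists_rep (𝒰.comul u)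
      obtain ⟨m, y', z', h'⟩ := BalTensor.exists_rep (𝒰.comul u')
      have hmul : π.coaction (u * u') =
          ∑ i, ∑ j, (y i * y' j) ⊗ᵇ (π.hom (z i) * π.hom (z' j)) := by
        simp [Hom.coaction, 𝒰.comul_mul u u' y z y' z' h h']
      simp only [LinearMap.coe_mk, AddHom.coe_mk, WTensor.mulLeft_tmul, hmul,
        Module.End.mul_apply, π.coaction_eq h, π.coaction_eq h', map_sum, WTensor.mulRight_tmul,
        mul_assoc]
      exact Finset.sum_comm)

@[simp]
theorem coactionEnd_tmul (u x : U) (v : V) :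
    π.coactionEnd u (x ⊗ᵇ v) = WTensor.mulRight x v (π.coaction u) := rfl

theorem coactionEnd_one_tmul_one (u : U) : π.coactionEnd u (1 ⊗ᵇ 1) = π.coaction u := by
  obtain ⟨n, x, y, h⟩ := BalTensor.exists_rep (π.coaction u)
  simp [h]

theorem coaction_mul (u u' : U) : π.coaction (u * u') = π.coactionEnd u (π.coaction u') := by
  rw [← coactionEnd_one_tmul_one, map_mul, Module.End.mul_apply, coactionEnd_one_tmul_one]

theorem coactionEnd_s (a : A) (x : U) (v : V) :
    π.coactionEnd (𝒰.s a) (x ⊗ᵇ v) = (𝒰.s a * x) ⊗ᵇ v := by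
  have coaction_s : π.coaction (𝒰.s a) = 𝒰.s a ⊗ᵇ 1 := (π.kernelUnit a).2
  simp [coaction_s]

theorem coactionEnd_t (a : A) (x : U) (v : V) :
    π.coactionEnd (𝒰.t (op a)) (x ⊗ᵇ v) = x ⊗ᵇ (𝒱.t (op a) * v) := by
  have coaction_t : π.coaction (𝒰.t (op a)) = 1 ⊗ᵇ 𝒱.t (op a) := by
    simpa [coaction_one] using π.coaction_t_mul a 1
  simp [coaction_t]

/-- The map `x ⊗ v ↦ x₍₁₎ ⊗ (π(x₍₂₎) ⊗ v)`. -/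
abbrev coactionId : WTensor 𝒰.t 𝒱.s →ₗ[k] 𝒱.Tensor3 𝒰.t :=
  𝒱.coactId π.coaction π.coaction_t_mul

theorem coactionId_coaction (u : U) :
    π.coactionId (π.coaction u) = 𝒱.idComul 𝒰.t (π.coaction u) := by
  let P : 𝒰.Tensor →ₗ[k] 𝒱.Tensor := BalTensor.map π.hom.toLinearMap π.hom.toLinearMap
    (fun a m => by simp [π.hom_t]) (fun a m => by simp [π.hom_s])
  have P_tmul (x y : U) : P (x ⊗ᵇ y) = π.hom x ⊗ᵇ π.hom y := rfl
  let F : 𝒰.Tensor3 𝒰.t →ₗ[k] 𝒱.Tensor3 𝒰.t :=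
    BalTensor.map LinearMap.id P (fun _ _ => rfl) (fun a X => by
      obtain ⟨n, x, y, rfl⟩ := BalTensor.exists_rep X
      simp [P_tmul, π.hom_s])
  have F_mkTensor3 (X : 𝒰.Tensor) (z : U) :
      F (𝒰.mkTensor3 𝒰.t X z) = 𝒱.mkTensor3 𝒰.t (π.idTensor X) (π.hom z) := by
    obtain ⟨n, x, y, rfl⟩ := BalTensor.exists_rep X
    simp [F, P_tmul]
  have key := congrArg F (𝒰.comulId_comul u)
  obtain ⟨n, x, y, h⟩ := BalTensor.exists_rep (𝒰.comul u)
  simpa [h, π.coaction_eq h, F_mkTensor3, F, P, Hom.coaction, π.comul_hom] using key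

theorem counitRight_coaction (u : U) : 𝒱.counitRight 𝒰.t (π.coaction u) = u := by
  obtain ⟨n, x, y, h⟩ := BalTensor.exists_rep (𝒰.comul u)
  simpa [π.coaction_eq h, π.counit_hom] using 𝒰.comul_counit u x y h

theorem isRightComoduleAlgebra_coaction :
    IsRightComoduleAlgebra 𝒱.toLeftBialgebroid 𝒰.t π.coaction where
  takeuchi := π.isTakeuchi_coaction
  right_linear a r n x y h := by simp [coaction_t_mul, h]
  coassoc r n m x y x' x'' h h' := by simpa [h, h'] using π.coactionId_coaction r
  counital r n x y h := by simpa [h] using π.counitRight_coaction r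
  mul r r' n m x y x' y' h h' := by
    simpa [coaction_mul, h, h'] using Finset.sum_comm
  one := π.coaction_one

theorem mem_kernel {u : U} : u ∈ π.kernel ↔ π.coaction u = u ⊗ᵇ 1 := Iff.rfl

theorem kernel_mul_t (b : π.kernel) (a : A) :
    (b : U) * 𝒰.t (op a) = 𝒰.t (op a) * (b : U) := π.mul_t_of_coaction b.2 a

theorem coe_kernelUnit (a : A) : (π.kernelUnit a : U) = 𝒰.s a := rfl

theorem coaction_kernel_mul (b : π.kernel) (u : U) :
    π.coaction ((b : U) * u) =
      mapFst (LinearMap.mulLeft k (b : U))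
        (fun a x => by simp [← mul_assoc, π.kernel_mul_t b a]) (π.coaction u) := by
  rw [coaction_mul]
  obtain ⟨n, x, y, h⟩ := BalTensor.exists_rep (π.coaction u)
  simp [h, π.mem_kernel.1 b.2]

theorem coaction_mul_kernel (b : π.kernel) (u : U) :
    π.coaction (u * (b : U)) = WTensor.mulRight (b : U) 1 (π.coaction u) := by
  simp [coaction_mul, π.mem_kernel.1 b.2]

end LeftHopfAlgebroid.Hom

/-! ### The retraction onto the Hopf kernel -/

section Cleaving

variable {k A U V R : Type*} [CommRing k] [Ring A] [Algebra k A]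
  [Ring U] [Algebra k U] [Ring V] [Algebra k V] [Ring R] [Algebra k R]
  {𝒰 : LeftHopfAlgebroid k A U} {𝒱 : LeftHopfAlgebroid k A V}

namespace CoringHom

variable (γ : CoringHom 𝒱.toLeftBialgebroid 𝒰.toLeftBialgebroid)

theorem comul_eq {v : V} {n : ℕ} {x y : Fin n → V} (h : 𝒱.comul v = ∑ i, x i ⊗ᵇ y i) :
    𝒰.comul (γ.hom v) = ∑ i, γ.hom (x i) ⊗ᵇ γ.hom (y i) := by
  rw [γ.comul_hom, h, map_sum]
  rfl

/-- The map `x ⊗ v ↦ x ⊗ γ(v)`. -/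
def idTensor : WTensor 𝒰.t 𝒱.s →ₗ[k] 𝒰.Tensor :=
  BalTensor.map LinearMap.id γ.hom (fun _ _ => rfl) (fun a v => γ.hom_s a v)

@[simp]
theorem idTensor_tmul (x : U) (v : V) : γ.idTensor (x ⊗ᵇ v) = x ⊗ᵇ γ.hom v := rfl

/-- The map `x ⊗ v ↦ x ⊗ (γ(v)₊ ⊗ γ(v)₋)`. -/
def idTranslation : WTensor 𝒰.t 𝒱.s →ₗ[k] 𝒰.MixedTensor :=
  𝒰.idTranslation 𝒰.t ∘ₗ γ.idTensor

@[simp]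
theorem idTranslation_tmul (x : U) (v : V) :
    γ.idTranslation (x ⊗ᵇ v) = x ⊗ᵇ 𝒰.translation (γ.hom v) := rfl

/-- The map `v ⊗ w ↦ γ(v)₊ ⊗ γ(v)₋ γ(w)`. -/
def galoisSymm : 𝒱.Tensor →ₗ[k] 𝒰.OpTensor :=
  𝒰.galois.symm.toLinearMap ∘ₗ
    BalTensor.map γ.hom γ.hom (fun a m => γ.hom_t (op a) m) (fun a m => γ.hom_s a m)

@[simp]
theorem galoisSymm_tmul (v w : V) :
    γ.galoisSymm (v ⊗ᵇ w) = 𝒰.opMulRight (γ.hom w) (𝒰.translation (γ.hom v)) :=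
  𝒰.galois_symm_tmul _ _

theorem galoisSymm_comul (v : V) : γ.galoisSymm (𝒱.comul v) = γ.hom v ⊗ᵇ 1 := by
  rw [← 𝒰.galois_symm_comul, γ.comul_hom]
  rfl

theorem galoisSymm_leftS (a : A) (X : 𝒱.Tensor) :
    γ.galoisSymm (𝒱.leftS a X) = 𝒰.opLeftS a (γ.galoisSymm X) := by
  obtain ⟨n, x, y, rfl⟩ := BalTensor.exists_rep X
  have opLeftS_opMulRight (z : U) (Y : 𝒰.OpTensor) :
      𝒰.opMulRight z (𝒰.opLeftS a Y) = 𝒰.opLeftS a (𝒰.opMulRight z Y) := by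
    obtain ⟨m, x', y', rfl⟩ := BalTensor.exists_rep Y
    simp
  simp [γ.hom_s, 𝒰.translation_s_mul, opLeftS_opMulRight]

end CoringHom

namespace LeftHopfAlgebroid.Hom

/-- A unital coring section `γ` of `π` that is linear for the right multiplications by the images
of source and target. -/
structure IsCleaving (π : 𝒰.Hom 𝒱)
    (γ : CoringHom 𝒱.toLeftBialgebroid 𝒰.toLeftBialgebroid) : Prop where
  split : ∀ v, π.hom (γ.hom v) = v
  one : γ.hom 1 = 1
  mul_t : ∀ (a : A) (v : V), γ.hom (v * 𝒱.t (op a)) = γ.hom v * 𝒰.t (op a)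
  mul_s : ∀ (a : A) (v : V), γ.hom (v * 𝒱.s a) = γ.hom v * 𝒰.s a

variable {π : 𝒰.Hom 𝒱} {γ : CoringHom 𝒱.toLeftBialgebroid 𝒰.toLeftBialgebroid}

theorem IsCleaving.isTakeuchi_idTensor (hγ : π.IsCleaving γ) {X : WTensor 𝒰.t 𝒱.s}
    (hX : IsTakeuchi X) : IsTakeuchi (γ.idTensor X) := by
  intro a
  have h := congrArg γ.idTensor (hX a)
  obtain ⟨n, x, v, rfl⟩ := BalTensor.exists_rep X
  simpa [hγ.mul_s] using h

theorem IsCleaving.isMixedTakeuchi_idTranslation (hγ : π.IsCleaving γ) {X : WTensor 𝒰.t 𝒱.s}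
    (hX : IsTakeuchi X) : 𝒰.IsMixedTakeuchi (γ.idTranslation X) := by
  intro a
  have h := congrArg γ.idTranslation (hX a)
  obtain ⟨n, x, v, rfl⟩ := BalTensor.exists_rep X
  simpa [hγ.mul_s, translation_mul_s] using h

theorem IsCleaving.coaction_section (hγ : π.IsCleaving γ) {v : V} {n : ℕ} {x y : Fin n → V}
    (h : 𝒱.comul v = ∑ i, x i ⊗ᵇ y i) :
    π.coaction (γ.hom v) = ∑ i, γ.hom (x i) ⊗ᵇ y i := by
  simp [π.coaction_eq (γ.comul_eq h), hγ.split]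

variable (π γ) (D : 𝒰.DualBasis)

/-- The retraction `u ↦ t(ε(γ(π(u₍₂₎))₊)) u₍₁₎ γ(π(u₍₂₎))₋` of `U` onto the Hopf kernel. -/
def retraction : U →ₗ[k] U := 𝒰.contract D ∘ₗ γ.idTranslation ∘ₗ π.coaction

theorem retraction_apply (u : U) :
    π.retraction γ D u = 𝒰.contract D (γ.idTranslation (π.coaction u)) := rfl

variable {π γ} in
theorem IsCleaving.contracts_iff (hγ : π.IsCleaving γ) {u : U} {X : 𝒰.MixedTensor}
    (hX : X = γ.idTranslation (π.coaction u)) (c : U) :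
    𝒰.Contracts X c ↔ c = π.retraction γ D u := by
  rw [hX, retraction_apply]
  exact 𝒰.contracts_iff D (hγ.isMixedTakeuchi_idTranslation (π.isTakeuchi_coaction u)) c

variable {π γ}

theorem IsCleaving.retraction_t_mul (hγ : π.IsCleaving γ) (a : A) (u : U) :
    π.retraction γ D (𝒰.t (op a) * u) = π.retraction γ D u * 𝒰.s a := by
  have h := 𝒰.contraction_mixedMulRight D (ρ := AlgHom.id k U) (fun _ => rfl)
    (hγ.isMixedTakeuchi_idTranslation (π.isTakeuchi_coaction u)) (𝒰.s a)
  rw [retraction_apply, retraction_apply, coaction_t_mul]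
  refine Eq.trans (congrArg _ ?_) h
  obtain ⟨n, x, v, h⟩ := BalTensor.exists_rep (π.coaction u)
  simp [h, γ.hom_t, translation_t_mul]

theorem IsCleaving.retraction_mul_t (hγ : π.IsCleaving γ) (a : A) (u : U) :
    π.retraction γ D u * 𝒰.t (op a) = 𝒰.t (op a) * π.retraction γ D u := by
  have hX := hγ.isMixedTakeuchi_idTranslation (π.isTakeuchi_coaction u)
  have mulRight := 𝒰.contraction_mixedMulRight D (ρ := AlgHom.id k U) (fun _ => rfl) hX
    (𝒰.t (op a))
  have tMul := 𝒰.contraction_mixedTMul D (ρ := AlgHom.id k U) (fun _ => rfl) hX a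
  refine mulRight.symm.trans (Eq.trans (congrArg _ ?_) tMul)
  obtain ⟨n, x, v, h⟩ := BalTensor.exists_rep (π.coaction u)
  simp [h, opTMul_translation]

theorem IsCleaving.retraction_kernel_mul (hγ : π.IsCleaving γ) (b : π.kernel) (u : U) :
    π.retraction γ D ((b : U) * u) = b * π.retraction γ D u := by
  have h := 𝒰.contraction_mapFst_mul D (ρ := AlgHom.id k U) (fun _ => rfl)
    (hγ.isMixedTakeuchi_idTranslation (π.isTakeuchi_coaction u)) (b : U)
    (fun a x => by simp [← mul_assoc, π.kernel_mul_t b a])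
  rw [retraction_apply, coaction_kernel_mul]
  refine Eq.trans (congrArg _ ?_) h
  obtain ⟨n, x, v, h⟩ := BalTensor.exists_rep (π.coaction u)
  simp [h]

/-- `φ(γ(v) b) = γ(v)₊ b γ(v)₋` for the retraction `φ`. -/
theorem IsCleaving.retraction_section_mul (hγ : π.IsCleaving γ) (v : V) (b : π.kernel) :
    π.retraction γ D (γ.hom v * b) =
      𝒰.opMul (AlgHom.id k U) (LinearMap.mulRight k (b : U))
        (fun a x => by simp [mul_assoc, π.kernel_mul_t b a]) (𝒰.translation (γ.hom v)) := by
  obtain ⟨n, x, y, h⟩ := BalTensor.exists_rep (𝒱.comul v)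
  rw [← 𝒰.sum_contraction_tmul_translation D (fun _ => rfl) _ (fun a x => by simp [mul_assoc])
    (fun a x => by simp [mul_assoc, π.kernel_mul_t b a]) (γ.comul_eq h), retraction_apply,
    coaction_mul_kernel, hγ.coaction_section h]
  simp

theorem IsCleaving.retraction_section (hγ : π.IsCleaving γ) (v : V) :
    π.retraction γ D (γ.hom v) = 𝒰.s (𝒱.counit v) := by
  have counit_section := 𝒰.opMul_mulLeft_translation (AlgHom.id k U) 1 (γ.hom v)
  obtain ⟨n, x, y, h⟩ := BalTensor.exists_rep (𝒰.translation (γ.hom v))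
  calc π.retraction γ D (γ.hom v) = ∑ i, x i * y i := by
        simpa [h] using hγ.retraction_section_mul D v 1
    _ = 𝒰.s (𝒱.counit v) := by simpa [h, γ.counit_hom] using counit_section

/-- The linear maps `d : U → R` for which both `d(u₍₁₎) ρ(γ(π(u₍₂₎)))` and
`t(ε(γ(π(u₍₂₎))₊)) d(u₍₁₎) ρ(γ(π(u₍₂₎))₋)` make sense, where `ρ : U → R` is an algebra map. -/
structure IsConvolvable (ρ : U →ₐ[k] R) (d : U →ₗ[k] R) : Prop where
  t_mul : ∀ a u, d (𝒰.t (op a) * u) = d u * ρ (𝒰.s a)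
  mul_t : ∀ a u, d u * ρ (𝒰.t (op a)) = ρ (𝒰.t (op a)) * d u

variable (γ) in
/-- The map `x ⊗ v ↦ d(x) ρ(γ(v))`; composed with the coaction it is the convolution product of
`d` with `ρ ∘ γ ∘ π`. -/
def convolution {ρ : U →ₐ[k] R} {d : U →ₗ[k] R} (hd : IsConvolvable (𝒰 := 𝒰) ρ d) :
    WTensor 𝒰.t 𝒱.s →ₗ[k] R :=
  BalTensor.lift ((LinearMap.mul k R).compl₁₂ d (ρ.toLinearMap ∘ₗ γ.hom))
    (fun a x v => by simp [hd.t_mul, γ.hom_s, mul_assoc])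

@[simp]
theorem convolution_tmul {ρ : U →ₐ[k] R} {d : U →ₗ[k] R} (hd : IsConvolvable (𝒰 := 𝒰) ρ d)
    (x : U) (v : V) : convolution γ hd (x ⊗ᵇ v) = d x * ρ (γ.hom v) := rfl

theorem convolution_t_mul {ρ : U →ₐ[k] R} {d : U →ₗ[k] R} (hd : IsConvolvable (𝒰 := 𝒰) ρ d)
    (a : A) (x : U) (v : V) : convolution γ hd (x ⊗ᵇ (𝒱.t (op a) * v)) =
      ρ (𝒰.t (op a)) * convolution γ hd (x ⊗ᵇ v) := by
  rw [convolution_tmul, convolution_tmul, γ.hom_t, map_mul, ← mul_assoc, hd.mul_t, mul_assoc]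

theorem IsCleaving.isConvolvable_retraction (hγ : π.IsCleaving γ) :
    IsConvolvable (𝒰 := 𝒰) (AlgHom.id k U) (π.retraction γ D) :=
  ⟨hγ.retraction_t_mul D, hγ.retraction_mul_t D⟩

/-- `u = φ(u₍₁₎) γ(π(u₍₂₎))` for the retraction `φ`. -/
theorem IsCleaving.convolution_retraction (hγ : π.IsCleaving γ) (u : U) :
    convolution γ (hγ.isConvolvable_retraction D) (π.coaction u) = u := by
  let F : 𝒱.Tensor3 𝒰.t →ₗ[k] 𝒰.MixedTensor := BalTensor.map LinearMap.id γ.galoisSymm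
    (fun _ _ => rfl) γ.galoisSymm_leftS
  have F_mkTensor3 (X : WTensor 𝒰.t 𝒱.s) (w : V) :
      F (𝒱.mkTensor3 𝒰.t X w) = 𝒰.mixedMulRight 𝒰.t (γ.hom w) (γ.idTranslation X) := by
    obtain ⟨n, x, v, rfl⟩ := BalTensor.exists_rep X
    simp [F]
  have F_comul (x : U) (w : V) : F (x ⊗ᵇ 𝒱.comul w) = x ⊗ᵇ (γ.hom w ⊗ᵇ 1) :=
    congrArg (x ⊗ᵇ ·) (γ.galoisSymm_comul w)
  obtain ⟨n, x, v, h⟩ := BalTensor.exists_rep (π.coaction u)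
  have coassoc : ∑ i, 𝒰.mixedMulRight 𝒰.t (γ.hom (v i)) (γ.idTranslation (π.coaction (x i))) =
      𝒰.mkMixed 𝒰.t (γ.idTensor (π.coaction u)) 1 := by
    simpa [h, F_mkTensor3, F_comul] using congrArg F (π.coactionId_coaction u)
  have mulRight (x : U) (w : U) :=
    𝒰.contraction_mixedMulRight D (ρ := AlgHom.id k U) (fun _ => rfl)
      (hγ.isMixedTakeuchi_idTranslation (π.isTakeuchi_coaction x)) w
  have eval := 𝒰.contraction_mkMixed D (ρ := AlgHom.id k U) (fun _ => rfl)
    (hγ.isTakeuchi_idTensor (π.isTakeuchi_coaction u)) 1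
  rw [← coassoc, map_sum] at eval
  have counit : 𝒰.counitRight 𝒰.t (γ.idTensor (π.coaction u)) = u := by
    simpa [h, γ.counit_hom] using π.counitRight_coaction u
  simp only [mulRight, counit, map_one, mul_one] at eval
  simpa [h, retraction_apply] using eval

variable (π) in
theorem sum_coaction_tmul {M' P' : Type*} [AddCommGroup M'] [Module k M'] [AddCommGroup P']
    [Module k P'] {r' : A → Module.End k M'} {l' : A → Module.End k P'}
    (f : WTensor 𝒰.t 𝒱.s →ₗ[k] M') (g : V →ₗ[k] P')
    (hf : ∀ a x v, f (x ⊗ᵇ (𝒱.t (op a) * v)) = r' a (f (x ⊗ᵇ v)))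
    (hg : ∀ a v, g (𝒱.s a * v) = l' a (g v)) {u : U} {n : ℕ} {x : Fin n → U} {v : Fin n → V}
    (h : π.coaction u = ∑ i, x i ⊗ᵇ v i) {m : Fin n → ℕ} {y z : ∀ i, Fin (m i) → V}
    (h' : ∀ i, 𝒱.comul (v i) = ∑ j, y i j ⊗ᵇ z i j) :
    ∑ i, (f (π.coaction (x i)) ⊗ᵇ g (v i) : BalTensor r' l') =
      ∑ i, ∑ j, f (x i ⊗ᵇ y i j) ⊗ᵇ g (z i j) := by
  let F := BalTensor.mapAssoc (L := 𝒱.leftS) (fun _ _ _ => rfl) f g hf hg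
  calc ∑ i, (f (π.coaction (x i)) ⊗ᵇ g (v i) : BalTensor r' l')
      = F (π.coactionId (π.coaction u)) := by
        rw [h, map_sum, map_sum]
        exact Finset.sum_congr rfl fun i _ =>
          (BalTensor.mapAssoc_insertRight _ f g hf hg (π.coaction (x i)) (v i)).symm
    _ = ∑ i, F (x i ⊗ᵇ 𝒱.comul (v i)) := by
        rw [coactionId_coaction, h, map_sum, map_sum]
        rfl
    _ = ∑ i, ∑ j, f (x i ⊗ᵇ y i j) ⊗ᵇ g (z i j) :=
        Finset.sum_congr rfl fun i _ => by
          rw [h']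
          exact (congrArg F (BalTensor.tmul_sum ..)).trans (map_sum F _ _)

section Cancellation

variable {ρ : U →ₐ[k] R} {d d' : U →ₗ[k] R}

/-- Convolution with `ρ ∘ γ ∘ π` is inverted by contraction against `γ(v)₊ ⊗ γ(v)₋`. -/
theorem IsConvolvable.contraction_convolution (hd : IsConvolvable (𝒰 := 𝒰) ρ d)
    {u : U} {n : ℕ} {x : Fin n → U} {v : Fin n → V} (h : π.coaction u = ∑ i, x i ⊗ᵇ v i) :
    𝒰.contraction D (ρ.comp 𝒰.t) ρ (∑ i, convolution γ hd (π.coaction (x i)) ⊗ᵇ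
      𝒰.translation (γ.hom (v i))) = d u := by
  choose m y z h' using fun i => BalTensor.exists_rep (𝒱.comul (v i))
  have coassoc := π.sum_coaction_tmul (convolution γ hd) (𝒰.translationL ∘ₗ γ.hom)
    (r' := fun a => LinearMap.mulLeft k (ρ.comp 𝒰.t (op a))) (l' := 𝒰.opLeftS)
    (convolution_t_mul hd) (fun a v => by simp [γ.hom_s, 𝒰.translation_s_mul]) h h'
  calc 𝒰.contraction D (ρ.comp 𝒰.t) ρ (∑ i, convolution γ hd (π.coaction (x i)) ⊗ᵇ
          𝒰.translation (γ.hom (v i)))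
      = ∑ i, d (x i) * ρ (𝒰.s (𝒱.counit (v i))) := by
        refine (congrArg _ coassoc).trans ?_
        rw [map_sum]
        refine Finset.sum_congr rfl fun i _ => ?_
        rw [map_sum, ← γ.counit_hom, ← 𝒰.opMul_mulLeft_translation,
          ← 𝒰.sum_contraction_tmul_translation D (t := ρ.comp 𝒰.t) (fun _ => rfl) _
            (fun a y => by simp [← mul_assoc, hd.mul_t]) (fun a y => by simp [mul_assoc])
            (γ.comul_eq (h' i))]
        rfl
    _ = d (𝒱.counitRight 𝒰.t (π.coaction u)) := by simp [h, hd.t_mul]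
    _ = d u := by rw [counitRight_coaction]

include D in
theorem IsConvolvable.eq_of_convolution_eq (hd : IsConvolvable (𝒰 := 𝒰) ρ d)
    (hd' : IsConvolvable (𝒰 := 𝒰) ρ d')
    (h : ∀ u, convolution γ hd (π.coaction u) = convolution γ hd' (π.coaction u)) : d = d' := by
  ext u
  obtain ⟨n, x, v, hu⟩ := BalTensor.exists_rep (π.coaction u)
  rw [← hd.contraction_convolution (γ := γ) D hu, ← hd'.contraction_convolution (γ := γ) D hu]
  simp only [h]

end Cancellation

/-- The map sending `u` to `x ⊗ v ↦ φ(u) x ⊗ v`, where `φ` is the retraction. -/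
def IsCleaving.retractionEnd (hγ : π.IsCleaving γ) : U →ₗ[k] Module.End k (WTensor 𝒰.t 𝒱.s) where
  toFun u := mapFst (LinearMap.mulLeft k (π.retraction γ D u))
    (fun a x => by simp [← mul_assoc, hγ.retraction_mul_t])
  map_add' u u' := BalTensor.ext fun x v => by
    simp only [mapFst_tmul, LinearMap.mulLeft_apply, map_add, add_mul, LinearMap.add_apply]
    exact BalTensor.add_tmul _ _ _
  map_smul' c u := BalTensor.ext fun x v => by
    simp only [mapFst_tmul, LinearMap.mulLeft_apply, map_smul, smul_mul_assoc,
      LinearMap.smul_apply, RingHom.id_apply]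
    exact BalTensor.smul_tmul _ _ _

@[simp]
theorem IsCleaving.retractionEnd_tmul (hγ : π.IsCleaving γ) (u x : U) (v : V) :
    hγ.retractionEnd D u (x ⊗ᵇ v) = (π.retraction γ D u * x) ⊗ᵇ v := rfl

/-- `φ(u₍₁₎) δ(γ(π(u₍₂₎))) = δ(u)` for the retraction `φ` and the coaction `δ`. -/
theorem IsCleaving.sum_retractionEnd_coaction (hγ : π.IsCleaving γ) {u : U} {n : ℕ}
    {x : Fin n → U} {v : Fin n → V} (h : π.coaction u = ∑ i, x i ⊗ᵇ v i) :
    ∑ i, hγ.retractionEnd D (x i) (π.coaction (γ.hom (v i))) = π.coaction u := by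
  choose m y z h' using fun i => BalTensor.exists_rep (𝒱.comul (v i))
  have coassoc := π.sum_coaction_tmul
    (r' := fun a => LinearMap.mulLeft k (𝒰.t (op a))) (l' := fun a => LinearMap.mulLeft k (𝒱.s a))
    (convolution γ (hγ.isConvolvable_retraction D)) LinearMap.id (convolution_t_mul _)
    (fun _ _ => rfl) h h'
  simp only [hγ.convolution_retraction, LinearMap.id_apply, ← h] at coassoc
  rw [coassoc]
  exact Finset.sum_congr rfl fun i _ => by simp [hγ.coaction_section (h' i)]

theorem IsCleaving.isConvolvable_retractionEnd (hγ : π.IsCleaving γ) :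
    IsConvolvable (𝒰 := 𝒰) π.coactionEnd (hγ.retractionEnd D) where
  t_mul a u := BalTensor.ext fun x v => by
    rw [Module.End.mul_apply, coactionEnd_s]
    simp [hγ.retraction_t_mul, mul_assoc]
  mul_t a u := BalTensor.ext fun x v => by
    rw [Module.End.mul_apply, Module.End.mul_apply, coactionEnd_t]
    simp only [retractionEnd_tmul]
    rw [coactionEnd_t]

theorem IsCleaving.convolution_retractionEnd (hγ : π.IsCleaving γ) (u : U) :
    convolution γ (hγ.isConvolvable_retractionEnd D) (π.coaction u) =
      π.coactionEnd u := by
  have retractionEnd_mulRight (u y : U) (w : V) (X : WTensor 𝒰.t 𝒱.s) :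
      hγ.retractionEnd D u (WTensor.mulRight y w X) =
        WTensor.mulRight y w (hγ.retractionEnd D u X) := by
    obtain ⟨n, x, v, rfl⟩ := BalTensor.exists_rep X
    simp [mul_assoc]
  obtain ⟨n, x, v, h⟩ := BalTensor.exists_rep (π.coaction u)
  refine BalTensor.ext fun y w => ?_
  rw [h, coactionEnd_tmul, ← hγ.sum_retractionEnd_coaction D h]
  simp [retractionEnd_mulRight]

theorem IsCleaving.retraction_mem (hγ : π.IsCleaving γ) (u : U) :
    π.retraction γ D u ∈ π.kernel := by
  have hφ : IsConvolvable (𝒰 := 𝒰) π.coactionEnd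
      (π.coactionEnd.toLinearMap ∘ₗ π.retraction γ D) :=
    ⟨fun a u => by simp [hγ.retraction_t_mul],
      fun a u => by simp [← map_mul, hγ.retraction_mul_t]⟩
  have hL := hγ.isConvolvable_retractionEnd D
  have h := hφ.eq_of_convolution_eq D hL fun u => by
    rw [hγ.convolution_retractionEnd]
    conv_rhs => rw [← hγ.convolution_retraction D u]
    obtain ⟨n, x, v, h⟩ := BalTensor.exists_rep (π.coaction u)
    simp [h]
  rw [mem_kernel, ← coactionEnd_one_tmul_one]
  simpa using LinearMap.congr_fun (LinearMap.congr_fun h u) (1 ⊗ᵇ 1)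

end LeftHopfAlgebroid.Hom

end Cleaving

/-! ### The crossed product -/

section Transport

variable {k A V R R' : Type*} [CommRing k] [Ring A] [Algebra k A] [Ring V] [Algebra k V]
  [Ring R] [Algebra k R] [Ring R'] [Algebra k R'] {s : A →ₐ[k] V}
  {t : Aᵐᵒᵖ →ₐ[k] R} {t' : Aᵐᵒᵖ →ₐ[k] R'} (e : R ≃ₐ[k] R') (he : ∀ a, e (t a) = t' a)

include he in
theorem symm_t_mul (a : A) (x : R') :
    e.symm.toLinearMap (t' (op a) * x) = t (op a) * e.symm.toLinearMap x := by
  simp [← he]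

/-- A coaction on `R'`, transported to `R` along an isomorphism `e : R ≃ R'`. -/
def transportCoaction (δ : R' →ₗ[k] WTensor t' s) : R →ₗ[k] WTensor t s :=
  mapFst e.symm.toLinearMap (symm_t_mul e he) ∘ₗ δ ∘ₗ e.toLinearMap

variable {e he} {δ : R' →ₗ[k] WTensor t' s} {r : R} {n : ℕ} {y : Fin n → V}

theorem transportCoaction_eq_sum {x : Fin n → R'} (h : δ (e r) = ∑ i, x i ⊗ᵇ y i) :
    transportCoaction e he δ r = ∑ i, e.symm (x i) ⊗ᵇ y i := by
  simp [transportCoaction, h]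

theorem eq_sum_of_transportCoaction_eq {x : Fin n → R}
    (h : transportCoaction e he δ r = ∑ i, x i ⊗ᵇ y i) : δ (e r) = ∑ i, e (x i) ⊗ᵇ y i := by
  obtain ⟨m, x', y', h'⟩ := BalTensor.exists_rep (δ (e r))
  rw [transportCoaction_eq_sum h'] at h
  simpa [h'] using congrArg (mapFst e.toLinearMap (fun a x => by simp [he])) h

theorem IsRightComoduleAlgebra.transport {𝒱 : LeftBialgebroid k A V}
    {δ : R' →ₗ[k] WTensor t' 𝒱.s} (h : IsRightComoduleAlgebra 𝒱 t' δ) :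
    IsRightComoduleAlgebra 𝒱 t (transportCoaction e he δ) where
  takeuchi r := IsTakeuchi.mapFst (h.takeuchi (e r)) _ (symm_t_mul e he) (fun a x => by simp [← he])
  right_linear a r n x y h' := by
    have key := h.right_linear a (e r) _ _ (eq_sum_of_transportCoaction_eq h')
    rw [← he, ← map_mul] at key
    simpa using transportCoaction_eq_sum key
  coassoc r n m x y x' x'' h' h'' := by
    have key := h.coassoc (e r) _ _ _ _ (eq_sum_of_transportCoaction_eq h')
      (fun i => eq_sum_of_transportCoaction_eq (h'' i))
    simpa using congrArg (mapFst e.symm.toLinearMap (symm_t_mul e he)) key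
  counital r n x y h' := by
    apply e.injective
    simpa [he] using h.counital (e r) _ _ (eq_sum_of_transportCoaction_eq h')
  mul r r' n m x y x' y' h₁ h₂ := by
    have key := h.mul (e r) (e r') _ _ _ _ (eq_sum_of_transportCoaction_eq h₁)
      (eq_sum_of_transportCoaction_eq h₂)
    simp [transportCoaction, key]
  one := by
    simp [transportCoaction, h.one]

end Transport

namespace LeftHopfAlgebroid.Hom

variable {k A U V : Type*} [CommRing k] [Ring A] [Algebra k A]
  [Ring U] [Algebra k U] [Ring V] [Algebra k V]
  {𝒰 : LeftHopfAlgebroid k A U} {𝒱 : LeftHopfAlgebroid k A V}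
  {γ : CoringHom 𝒱.toLeftBialgebroid 𝒰.toLeftBialgebroid} {π : 𝒰.Hom 𝒱}

variable (π γ) in
/-- The map `b ⊗ v ↦ b γ(v)`. -/
def mulSection : BTensor 𝒱.toLeftBialgebroid π.kernelUnit →ₗ[k] U :=
  BalTensor.lift ((LinearMap.mul k U).compl₁₂ π.kernel.val.toLinearMap γ.hom)
    (fun a b v => by simp [γ.hom_s, coe_kernelUnit, mul_assoc])

@[simp]
theorem mulSection_tmul (b : π.kernel) (v : V) : π.mulSection γ (b ⊗ᵇ v) = b * γ.hom v := rfl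

namespace IsCleaving

variable (hγ : π.IsCleaving γ) (D : 𝒰.DualBasis)

/-- The retraction of `U` onto the left Hopf kernel of `π`. -/
def toKernel : U →ₗ[k] π.kernel :=
  (π.retraction γ D).codRestrict (Subalgebra.toSubmodule π.kernel) (hγ.retraction_mem D)

theorem coe_toKernel (u : U) : (hγ.toKernel D u : U) = π.retraction γ D u := rfl

theorem toKernel_kernel_mul (b : π.kernel) (u : U) :
    hγ.toKernel D (b * u) = b * hγ.toKernel D u :=
  Subtype.ext (hγ.retraction_kernel_mul D b u)

theorem toKernel_s_mul (a : A) (u : U) :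
    hγ.toKernel D (𝒰.s a * u) = π.kernelUnit a * hγ.toKernel D u :=
  hγ.toKernel_kernel_mul D (π.kernelUnit a) u

theorem toKernel_t_mul (a : A) (u : U) :
    hγ.toKernel D (𝒰.t (op a) * u) = hγ.toKernel D u * π.kernelUnit a :=
  Subtype.ext (hγ.retraction_t_mul D a u)

theorem toKernel_section (v : V) :
    hγ.toKernel D (γ.hom v) = π.kernelUnit (𝒱.counit v) :=
  Subtype.ext (hγ.retraction_section D v)

theorem toKernel_coe (b : π.kernel) : hγ.toKernel D b = b := by
  have h := hγ.toKernel_kernel_mul D b (γ.hom 1)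
  rwa [toKernel_section, 𝒱.counit_one, map_one π.kernelUnit, hγ.one, mul_one, mul_one] at h

/-- `u = φ(u₍₁₎) γ(π(u₍₂₎))` for the retraction `φ`. -/
theorem sum_toKernel_mul_section {u : U} {n : ℕ} {x : Fin n → U} {v : Fin n → V}
    (h : π.coaction u = ∑ i, x i ⊗ᵇ v i) :
    ∑ i, (hγ.toKernel D (x i) : U) * γ.hom (v i) = u := by
  simpa [h, coe_toKernel] using hγ.convolution_retraction D u

section Comul

variable {v w : V} {n m : ℕ} {x y : Fin n → V} {x' y' : Fin m → V}

include hγ in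
theorem coaction_section_mul_section (hv : 𝒱.comul v = ∑ i, x i ⊗ᵇ y i)
    (hw : 𝒱.comul w = ∑ j, x' j ⊗ᵇ y' j) :
    π.coaction (γ.hom v * γ.hom w) =
      ∑ i, ∑ j, (γ.hom (x i) * γ.hom (x' j)) ⊗ᵇ (y i * y' j) :=
  π.isRightComoduleAlgebra_coaction.mul _ _ _ _ _ _ (hγ.coaction_section hv)
    (hγ.coaction_section hw)

theorem section_mul_kernel (hv : 𝒱.comul v = ∑ i, x i ⊗ᵇ y i) (b : π.kernel) :
    γ.hom v * b = ∑ i, (hγ.toKernel D (γ.hom (x i) * b) : U) * γ.hom (y i) := by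
  refine (hγ.sum_toKernel_mul_section D ?_).symm
  simp [coaction_mul_kernel, hγ.coaction_section hv]

theorem section_mul_section (hv : 𝒱.comul v = ∑ i, x i ⊗ᵇ y i)
    (hw : 𝒱.comul w = ∑ j, x' j ⊗ᵇ y' j) :
    γ.hom v * γ.hom w = ∑ i, ∑ j,
      (hγ.toKernel D (γ.hom (x i) * γ.hom (x' j)) : U) * γ.hom (y i * y' j) := by
  conv_lhs => rw [← hγ.convolution_retraction D (γ.hom v * γ.hom w),
    hγ.coaction_section_mul_section hv hw]
  simp [coe_toKernel]

theorem toKernel_section_mul_kernel_mul (hv : 𝒱.comul v = ∑ i, x i ⊗ᵇ y i) (b : π.kernel)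
    (u : U) :
    hγ.toKernel D (γ.hom v * (b * u)) =
      ∑ i, hγ.toKernel D (γ.hom (x i) * b) * hγ.toKernel D (γ.hom (y i) * u) := by
  rw [← mul_assoc, hγ.section_mul_kernel D hv, Finset.sum_mul, map_sum]
  simp only [mul_assoc, toKernel_kernel_mul]

theorem toKernel_section_mul_section_mul (hv : 𝒱.comul v = ∑ i, x i ⊗ᵇ y i)
    (hw : 𝒱.comul w = ∑ j, x' j ⊗ᵇ y' j) (u : U) :
    hγ.toKernel D (γ.hom v * (γ.hom w * u)) = ∑ i, ∑ j,
      hγ.toKernel D (γ.hom (x i) * γ.hom (x' j)) * hγ.toKernel D (γ.hom (y i * y' j) * u) := by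
  rw [← mul_assoc, hγ.section_mul_section D hv hw]
  simp only [Finset.sum_mul, map_sum, mul_assoc, toKernel_kernel_mul]

end Comul

/-- The weak action `v ⇀ b = φ(γ(v) b)` on the left Hopf kernel, for the retraction `φ`. -/
def measuring : Measuring 𝒱.toLeftBialgebroid π.kernelUnit where
  act := LinearMap.mk₂ k (fun v b => hγ.toKernel D (γ.hom v * b))
    (fun _ _ _ => by simp [add_mul]) (fun _ _ _ => by simp)
    (fun _ _ _ => by simp [mul_add]) (fun _ _ _ => by simp)
  act_white a a' v b := by
    simp only [LinearMap.mk₂_apply, mul_assoc, γ.hom_s, γ.hom_t, toKernel_s_mul, toKernel_t_mul]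
  act_one v := by
    simp only [LinearMap.mk₂_apply, OneMemClass.coe_one, mul_one, toKernel_section]
  act_mul v b b' n x y h := by
    simp only [LinearMap.mk₂_apply, MulMemClass.coe_mul]
    exact hγ.toKernel_section_mul_kernel_mul D h b b'

theorem measuring_act (v : V) (b : π.kernel) :
    (hγ.measuring D).act v b = hγ.toKernel D (γ.hom v * b) := rfl

theorem coe_measuring_act_eq_sum (v : V) (b : π.kernel) {n : ℕ} (x y : Fin n → U)
    (h : 𝒰.translation (γ.hom v) = ∑ i, x i ⊗ᵇ y i) :
    ((hγ.measuring D).act v b : U) = ∑ i, x i * (b : U) * y i := by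
  simp [measuring_act, coe_toKernel, hγ.retraction_section_mul, h]

/-- The cocycle `σ(v, w) = φ(γ(v) γ(w))`, for the retraction `φ`. -/
def cocycle : 𝒱.OpTensor →ₗ[k] π.kernel :=
  BalTensor.lift (((LinearMap.mul k U).compl₁₂ γ.hom γ.hom).compr₂ (hγ.toKernel D))
    (fun a v w => by
      have := γ.hom_t (op a) w
      simp [hγ.mul_t, this, mul_assoc])

theorem cocycle_tmul (v w : V) :
    hγ.cocycle D (v ⊗ᵇ w) = hγ.toKernel D (γ.hom v * γ.hom w) := rfl

theorem contracts_iff_eq_cocycle (v w : V) {n m : ℕ} (x y : Fin n → V) (x' y' : Fin m → V)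
    (hv : 𝒱.comul v = ∑ i, x i ⊗ᵇ y i) (hw : 𝒱.comul w = ∑ j, x' j ⊗ᵇ y' j) (c : U) :
    𝒰.Contracts (∑ i, ∑ j, (γ.hom (x i) * γ.hom (x' j)) ⊗ᵇ 𝒰.translation (γ.hom (y i * y' j))) c
      ↔ c = hγ.cocycle D (v ⊗ᵇ w) := by
  refine hγ.contracts_iff D ?_ c
  simp [hγ.coaction_section_mul_section hv hw]

theorem contracts_iff_eq_toKernel (u : U) {n : ℕ} (x y : Fin n → U)
    (hu : 𝒰.comul u = ∑ i, x i ⊗ᵇ y i) (c : U) :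
    𝒰.Contracts (∑ i, x i ⊗ᵇ 𝒰.translation (γ.hom (π.hom (y i)))) c ↔ c = hγ.toKernel D u := by
  refine hγ.contracts_iff D ?_ c
  simp [π.coaction_eq hu]

theorem isTwistedModule : IsTwistedModule (hγ.measuring D) (hγ.cocycle D) where
  white a a' v w := by
    simp only [cocycle_tmul, mul_assoc, γ.hom_s, γ.hom_t, toKernel_s_mul, toKernel_t_mul]
  act_unit a u v n x y h := by
    simp only [cocycle_tmul, measuring_act, γ.hom_s]
    exact (hγ.toKernel_section_mul_kernel_mul D h (π.kernelUnit a) (γ.hom v)).symm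
  one_left u := by rw [cocycle_tmul, hγ.one, one_mul, toKernel_section]
  one_right u := by rw [cocycle_tmul, hγ.one, mul_one, toKernel_section]
  cocycle u v w n m l x y x' y' x'' y'' hu hv hw := by
    simp only [cocycle_tmul, measuring_act]
    rw [← hγ.toKernel_section_mul_section_mul D hu hv, hγ.section_mul_section D hv hw]
    simp only [Finset.mul_sum, map_sum, hγ.toKernel_section_mul_kernel_mul D hu]
    rw [Finset.sum_comm]
    exact Finset.sum_congr rfl fun j _ => Finset.sum_comm
  one_act b := by rw [measuring_act, hγ.one, one_mul, toKernel_coe]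
  twisted u v b n m x y x' y' hu hv := by
    simp only [cocycle_tmul, measuring_act]
    rw [← hγ.toKernel_section_mul_section_mul D hu hv, hγ.section_mul_kernel D hv]
    simp only [Finset.mul_sum, map_sum, hγ.toKernel_section_mul_kernel_mul D hu]
    exact Finset.sum_comm

/-- The map `x ⊗ v ↦ φ(x) ⊗ v`, for the retraction `φ`. -/
def toKernelTensor : WTensor 𝒰.t 𝒱.s →ₗ[k] BTensor 𝒱.toLeftBialgebroid π.kernelUnit :=
  BalTensor.map (hγ.toKernel D) LinearMap.id (fun a x => hγ.toKernel_t_mul D a x)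
    (fun _ _ => rfl)

@[simp]
theorem toKernelTensor_tmul (x : U) (v : V) :
    hγ.toKernelTensor D (x ⊗ᵇ v) = hγ.toKernel D x ⊗ᵇ v := rfl

theorem mulSection_toKernelTensor_coaction (u : U) :
    π.mulSection γ (hγ.toKernelTensor D (π.coaction u)) = u := by
  obtain ⟨n, x, v, h⟩ := BalTensor.exists_rep (π.coaction u)
  simpa [h] using hγ.sum_toKernel_mul_section D h

theorem toKernelTensor_coaction_mulSection (X : BTensor 𝒱.toLeftBialgebroid π.kernelUnit) :
    hγ.toKernelTensor D (π.coaction (π.mulSection γ X)) = X := by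
  induction X using BalTensor.induction_on with
  | zero => simp
  | tmul b v =>
    obtain ⟨n, x, y, h⟩ := BalTensor.exists_rep (𝒱.comul v)
    have kernelUnit_tmul (a : A) (y : V) : ((b * π.kernelUnit a) ⊗ᵇ y :
        BTensor 𝒱.toLeftBialgebroid π.kernelUnit) = b ⊗ᵇ (𝒱.s a * y) :=
      BalTensor.act_tmul a b y
    calc hγ.toKernelTensor D (π.coaction (b * γ.hom v))
        = ∑ i, (b * π.kernelUnit (𝒱.counit (x i))) ⊗ᵇ y i := by
          simp [coaction_kernel_mul, hγ.coaction_section h, toKernel_kernel_mul, toKernel_section]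
      _ = b ⊗ᵇ v := by
          simp only [kernelUnit_tmul]
          rw [← BalTensor.tmul_sum, 𝒱.counit_comul v x y h]
  | add X Y hX hY => simp [hX, hY]

/-- The linear isomorphism `B ⊗_A V ≃ U`, `b ⊗ v ↦ b γ(v)`. -/
def tensorEquiv : BTensor 𝒱.toLeftBialgebroid π.kernelUnit ≃ₗ[k] U :=
  LinearEquiv.ofLinearMap (π.mulSection γ) (hγ.toKernelTensor D ∘ₗ π.coaction)
    (LinearMap.ext (hγ.mulSection_toKernelTensor_coaction D))
    (LinearMap.ext (hγ.toKernelTensor_coaction_mulSection D))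

theorem tensorEquiv_tmul (b : π.kernel) (v : V) :
    hγ.tensorEquiv D (b ⊗ᵇ v) = b * γ.hom v := rfl

theorem tensorEquiv_symm_apply (u : U) :
    (hγ.tensorEquiv D).symm u = hγ.toKernelTensor D (π.coaction u) := rfl

/-- The crossed product multiplication on `B ⊗_A V`, transported from `U`. -/
def crossedProduct : CrossedProduct (hγ.measuring D) (hγ.cocycle D) where
  mul := ((LinearMap.mul k U).compl₁₂ (hγ.tensorEquiv D).toLinearMap
    (hγ.tensorEquiv D).toLinearMap).compr₂ (hγ.tensorEquiv D).symm.toLinearMap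
  mul_tmul b b' v w n m l v₁ v₂₃ v₂ v₃ w₁ w₂ hv hv₂₃ hw := by
    simp only [LinearMap.compr₂_apply, LinearMap.compl₁₂_apply, LinearEquiv.coe_coe,
      LinearMap.mul_apply']
    rw [LinearEquiv.symm_apply_eq]
    simp only [map_sum, tensorEquiv_tmul, cocycle_tmul, measuring_act, MulMemClass.coe_mul]
    rw [mul_assoc, ← mul_assoc (γ.hom v), hγ.section_mul_kernel D hv, Finset.sum_mul,
      Finset.mul_sum]
    refine Finset.sum_congr rfl fun i _ => ?_
    rw [mul_assoc, hγ.section_mul_section D (hv₂₃ i) hw]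
    simp only [Finset.mul_sum, mul_assoc]
  mul_assoc x y z := by simp [mul_assoc]
  one_mul x := by simp [tensorEquiv_tmul, hγ.one]
  mul_one x := by simp [tensorEquiv_tmul, hγ.one]

/-- The algebra isomorphism `B #_σ V ≃ U`, `b # v ↦ b γ(v)`. -/
def crossedEquiv : (hγ.crossedProduct D).Carrier ≃ₐ[k] U :=
  AlgEquiv.ofLinearEquiv (R := k) (A₁ := (hγ.crossedProduct D).Carrier) (hγ.tensorEquiv D)
    (by
      change hγ.tensorEquiv D (1 ⊗ᵇ 1) = 1
      simp [tensorEquiv_tmul, hγ.one])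
    (fun x y => (hγ.tensorEquiv D).apply_symm_apply _)

theorem crossedEquiv_tmul (b : π.kernel) (v : V) :
    hγ.crossedEquiv D ((hγ.crossedProduct D).tmul b v) = b * γ.hom v := rfl

theorem crossedEquiv_symm_eq_sum (u : U) {n : ℕ} (x y : Fin n → U)
    (h : 𝒰.comul u = ∑ i, x i ⊗ᵇ y i) : (hγ.crossedEquiv D).symm u =
      ∑ i, (hγ.crossedProduct D).tmul (hγ.toKernel D (x i)) (π.hom (y i)) := by
  refine (hγ.tensorEquiv_symm_apply D u).trans ?_
  rw [π.coaction_eq h, map_sum]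
  rfl

/-- The `A ⊗ Aᵒᵖ`-ring structure `a ⊗ a' ↦ s(a) # t(a')` of the crossed product, transported
from `U`. -/
def crossedEnvRing : EnvRing k A (hγ.crossedProduct D).Carrier where
  s := ((hγ.crossedEquiv D).symm : U →ₐ[k] _).comp 𝒰.s
  t := ((hγ.crossedEquiv D).symm : U →ₐ[k] _).comp 𝒰.t
  comm a b := by simp [← map_mul, 𝒰.comm]

theorem crossedEquiv_s (a : A) : hγ.crossedEquiv D ((hγ.crossedEnvRing D).s a) = 𝒰.s a :=
  (hγ.crossedEquiv D).apply_symm_apply _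

theorem crossedEquiv_t (a : Aᵐᵒᵖ) : hγ.crossedEquiv D ((hγ.crossedEnvRing D).t a) = 𝒰.t a :=
  (hγ.crossedEquiv D).apply_symm_apply _

theorem crossedEnvRing_s_mul_t (a a' : A) :
    (hγ.crossedEnvRing D).s a * (hγ.crossedEnvRing D).t (op a') =
      (hγ.crossedProduct D).tmul (π.kernelUnit a) (𝒱.t (op a')) := by
  apply (hγ.crossedEquiv D).injective
  have section_t : γ.hom (𝒱.t (op a')) = 𝒰.t (op a') := by
    simpa [hγ.one] using γ.hom_t (op a') 1
  rw [map_mul, crossedEquiv_s, crossedEquiv_t, crossedEquiv_tmul, section_t, coe_kernelUnit]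

/-- The coaction `b # v ↦ (b # v₍₁₎) ⊗ v₍₂₎` of the crossed product, transported from `U`. -/
def crossedCoaction : (hγ.crossedProduct D).Carrier →ₗ[k] WTensor (hγ.crossedEnvRing D).t 𝒱.s :=
  transportCoaction (hγ.crossedEquiv D) (hγ.crossedEquiv_t D) π.coaction

theorem crossedCoaction_tmul (b : π.kernel) (v : V) {n : ℕ} (x y : Fin n → V)
    (h : 𝒱.comul v = ∑ i, x i ⊗ᵇ y i) :
    hγ.crossedCoaction D ((hγ.crossedProduct D).tmul b v) =
      ∑ i, (hγ.crossedProduct D).tmul b (x i) ⊗ᵇ y i := by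
  have coaction_mul : π.coaction (hγ.crossedEquiv D ((hγ.crossedProduct D).tmul b v)) =
      ∑ i, ((b : U) * γ.hom (x i)) ⊗ᵇ y i := by
    simp [crossedEquiv_tmul, coaction_kernel_mul, hγ.coaction_section h]
  refine (transportCoaction_eq_sum coaction_mul).trans ?_
  simp only [← hγ.crossedEquiv_tmul D, AlgEquiv.symm_apply_apply]

theorem isRightComoduleAlgebra_crossedCoaction :
    IsRightComoduleAlgebra 𝒱.toLeftBialgebroid (hγ.crossedEnvRing D).t (hγ.crossedCoaction D) :=
  π.isRightComoduleAlgebra_coaction.transport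

theorem coaction_crossedEquiv (r : (hγ.crossedProduct D).Carrier) {n : ℕ}
    (x : Fin n → (hγ.crossedProduct D).Carrier) (y : Fin n → V)
    (h : hγ.crossedCoaction D r = ∑ i, x i ⊗ᵇ y i) :
    π.coaction (hγ.crossedEquiv D r) = ∑ i, hγ.crossedEquiv D (x i) ⊗ᵇ y i :=
  eq_sum_of_transportCoaction_eq h

end IsCleaving

end LeftHopfAlgebroid.Hom

end Bialgd

end

theorem theorem2p8_general {k A U V : Type*} [CommRing k] [Ring A] [Algebra k A]
    [Ring U] [Algebra k U] [Ring V] [Algebra k V]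
    (𝒰 : LeftHopfAlgebroid k A U) (𝒱 : LeftHopfAlgebroid k A V)
    (π : 𝒰.Hom 𝒱)
    (γ : CoringHom 𝒱.toLeftBialgebroid 𝒰.toLeftBialgebroid) (hγ : π.IsCleaving γ)
    (hproj : 𝒰.WhiteRightProjective) :
    ∃ (M : Measuring 𝒱.toLeftBialgebroid π.kernelUnit) (σ : 𝒱.OpTensor →ₗ[k] π.kernel),
      (∀ (v : V) (b : π.kernel) {n : ℕ} (x y : Fin n → U),
        𝒰.translation (γ.hom v) = ∑ i, x i ⊗ᵇ y i →
        (M.act v b : U) = ∑ i, x i * (b : U) * y i) ∧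
      (∀ (v w : V) {n m : ℕ} (x y : Fin n → V) (x' y' : Fin m → V),
        𝒱.comul v = ∑ i, x i ⊗ᵇ y i → 𝒱.comul w = ∑ j, x' j ⊗ᵇ y' j →
        ∀ c : U, 𝒰.Contracts
          (∑ i, ∑ j, (γ.hom (x i) * γ.hom (x' j)) ⊗ᵇ 𝒰.translation (γ.hom (y i * y' j))) c ↔
          c = σ (v ⊗ᵇ w)) ∧
      IsTwistedModule M σ ∧
      ∃ (C : CrossedProduct M σ) (E : EnvRing k A C.Carrier)
        (δ : C.Carrier →ₗ[k] WTensor E.t 𝒱.s) (Φ : C.Carrier ≃ₐ[k] U),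
        (∀ a a' : A, E.s a * E.t (op a') = C.tmul (π.kernelUnit a) (𝒱.t (op a'))) ∧
        (∀ (b : π.kernel) (v : V) {n : ℕ} (x y : Fin n → V), 𝒱.comul v = ∑ i, x i ⊗ᵇ y i →
          δ (C.tmul b v) = ∑ i, C.tmul b (x i) ⊗ᵇ y i) ∧
        IsRightComoduleAlgebra 𝒱.toLeftBialgebroid E.t δ ∧
        IsRightComoduleAlgebra 𝒱.toLeftBialgebroid 𝒰.t π.coaction ∧
        (∀ (b : π.kernel) (v : V), Φ (C.tmul b v) = (b : U) * γ.hom v) ∧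
        (∀ a, Φ (E.s a) = 𝒰.s a) ∧
        (∀ a, Φ (E.t a) = 𝒰.t a) ∧
        (∀ (r : C.Carrier) {n : ℕ} (x : Fin n → C.Carrier) (y : Fin n → V),
          δ r = ∑ i, x i ⊗ᵇ y i → π.coaction (Φ r) = ∑ i, Φ (x i) ⊗ᵇ y i) ∧
        ∃ φ : U →ₗ[k] π.kernel,
          (∀ (u : U) {n : ℕ} (x y : Fin n → U), 𝒰.comul u = ∑ i, x i ⊗ᵇ y i →
            ∀ c : U, 𝒰.Contracts
              (∑ i, x i ⊗ᵇ 𝒰.translation (γ.hom (π.hom (y i)))) c ↔ c = φ u) ∧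
          (∀ (u : U) {n : ℕ} (x y : Fin n → U), 𝒰.comul u = ∑ i, x i ⊗ᵇ y i →
            Φ.symm u = ∑ i, C.tmul (φ (x i)) (π.hom (y i))) := by
  obtain ⟨D⟩ := hproj.nonempty_dualBasis
  exact ⟨hγ.measuring D, hγ.cocycle D, hγ.coe_measuring_act_eq_sum D,
    hγ.contracts_iff_eq_cocycle D, hγ.isTwistedModule D,
    hγ.crossedProduct D, hγ.crossedEnvRing D, hγ.crossedCoaction D, hγ.crossedEquiv D,
    hγ.crossedEnvRing_s_mul_t D, hγ.crossedCoaction_tmul D,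
    hγ.isRightComoduleAlgebra_crossedCoaction D, π.isRightComoduleAlgebra_coaction,
    hγ.crossedEquiv_tmul D, hγ.crossedEquiv_s D, hγ.crossedEquiv_t D, hγ.coaction_crossedEquiv D,
    hγ.toKernel D, hγ.contracts_iff_eq_toKernel D, hγ.crossedEquiv_symm_eq_sum D⟩

theorem theorem2p8 {k A U V : Type*} [Field k] [CharZero k] [Ring A] [Algebra k A]
    [Ring U] [Algebra k U] [Ring V] [Algebra k V]
    (𝒰 : LeftHopfAlgebroid k A U) (𝒱 : LeftHopfAlgebroid k A V)
    (π : 𝒰.Hom 𝒱) (hπ : Function.Surjective π.hom)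
    (γ : CoringHom 𝒱.toLeftBialgebroid 𝒰.toLeftBialgebroid)
    (hsplit : ∀ v, π.hom (γ.hom v) = v)
    (hproj : 𝒰.WhiteRightProjective)
    (hone : γ.hom 1 = 1)
    (hblack_left : ∀ (a : A) (v : V), γ.hom (v * 𝒱.t (op a)) = γ.hom v * 𝒰.t (op a))
    (hblack_right : ∀ (a : A) (v : V), γ.hom (v * 𝒱.s a) = γ.hom v * 𝒰.s a) :
    ∃ (M : Measuring 𝒱.toLeftBialgebroid π.kernelUnit) (σ : 𝒱.OpTensor →ₗ[k] π.kernel),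
      -- `v ▷ b = γ(v)₊ b γ(v)₋`
      (∀ (v : V) (b : π.kernel) {n : ℕ} (x y : Fin n → U),
        𝒰.translation (γ.hom v) = ∑ i, x i ⊗ᵇ y i →
        (M.act v b : U) = ∑ i, x i * (b : U) * y i) ∧
      -- `σ(v, w) = t(ε(γ(v₍₂₎ w₍₂₎)₊)) γ(v₍₁₎) γ(w₍₁₎) γ(v₍₂₎ w₍₂₎)₋`
      (∀ (v w : V) {n m : ℕ} (x y : Fin n → V) (x' y' : Fin m → V),
        𝒱.comul v = ∑ i, x i ⊗ᵇ y i → 𝒱.comul w = ∑ j, x' j ⊗ᵇ y' j →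
        ∀ c : U, 𝒰.Contracts
          (∑ i, ∑ j, (γ.hom (x i) * γ.hom (x' j)) ⊗ᵇ 𝒰.translation (γ.hom (y i * y' j))) c ↔
          c = σ (v ⊗ᵇ w)) ∧
      IsTwistedModule M σ ∧
      ∃ (C : CrossedProduct M σ) (E : EnvRing k A C.Carrier)
        (δ : C.Carrier →ₗ[k] WTensor E.t 𝒱.s) (Φ : C.Carrier ≃ₐ[k] U),
        -- the `A ⊗ Aᵒᵖ`-ring structure of `B #_σ V`
        (∀ a a' : A, E.s a * E.t (op a') = C.tmul (π.kernelUnit a) (𝒱.t (op a'))) ∧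
        -- the right `V`-comodule algebra structures of `B #_σ V` and `U`
        (∀ (b : π.kernel) (v : V) {n : ℕ} (x y : Fin n → V), 𝒱.comul v = ∑ i, x i ⊗ᵇ y i →
          δ (C.tmul b v) = ∑ i, C.tmul b (x i) ⊗ᵇ y i) ∧
        IsRightComoduleAlgebra 𝒱.toLeftBialgebroid E.t δ ∧
        IsRightComoduleAlgebra 𝒱.toLeftBialgebroid 𝒰.t π.coaction ∧
        -- `Φ` is an isomorphism of `A ⊗ Aᵒᵖ`-rings and of right `V`-comodule algebras
        (∀ (b : π.kernel) (v : V), Φ (C.tmul b v) = (b : U) * γ.hom v) ∧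
        (∀ a, Φ (E.s a) = 𝒰.s a) ∧
        (∀ a, Φ (E.t a) = 𝒰.t a) ∧
        (∀ (r : C.Carrier) {n : ℕ} (x : Fin n → C.Carrier) (y : Fin n → V),
          δ r = ∑ i, x i ⊗ᵇ y i → π.coaction (Φ r) = ∑ i, Φ (x i) ⊗ᵇ y i) ∧
        -- the inverse, `u ↦ t(ε(γ(π(u₍₂₎))₊)) u₍₁₎ γ(π(u₍₂₎))₋ # π(u₍₃₎)`
        ∃ φ : U →ₗ[k] π.kernel,
          (∀ (u : U) {n : ℕ} (x y : Fin n → U), 𝒰.comul u = ∑ i, x i ⊗ᵇ y i →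
            ∀ c : U, 𝒰.Contracts
              (∑ i, x i ⊗ᵇ 𝒰.translation (γ.hom (π.hom (y i)))) c ↔ c = φ u) ∧
          (∀ (u : U) {n : ℕ} (x y : Fin n → U), 𝒰.comul u = ∑ i, x i ⊗ᵇ y i →
            Φ.symm u = ∑ i, C.tmul (φ (x i)) (π.hom (y i))) := by
  exact theorem2p8_general 𝒰 𝒱 π γ ⟨hsplit, hone, hblack_left, hblack_right⟩ hproj
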